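/- Let $n\ge 1$ and $m\ge 0$ be integers and let $V=\{(i,j)\in\mathbb Z^2: 0\le i\le n,\ 0\le j\le i+m\}$. For an array $X=(x_{ij})_{(i,j)\in V}$ of reals put $\partial x_{ij}=x_{ij}-x_{i,j-1}$ ($0\le i\le n$, $1\le j\le i+m$). Call $X$ strip-concave if $\partial x_{ij}\ge\partial x_{i-1,j}\ge\partial x_{i,j+1}$ for all $1\le i\le n$, $1\le j\le i-1+m$. The boundary quadruple of $X$ is $(\lambda,\overline\lambda,\mu,\nu)\in\mathbb R^{n+m}\times\mathbb R^m\times\mathbb R^n\times\mathbb R^n$ with $\lambda_j=\partial x_{nj}$, $\overline\lambda_j=\partial x_{0j}$, $\mu_i=x_{i0}-x_{i-1,0}$, $\nu_i=x_{i,i+m}-x_{i-1,i-1+m}$. Let $\mathcal B_V$ be the polyhedral cone of all boundary quadruples of strip-concave arrays $X$ with $x_{00}=0$. A facet of $\mathcal B_V$ is a nonempty face of dimension $\dim\mathcal B_V-1$, and an inequality determines a facet if it is valid on $\mathcal B_V$ and the points of $\mathcal B_V$ where it holds with equality form a facet. **Theorem 3.** For $I\subseteq\{1,\dots,n\}$ and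 $J\subseteq\{1,\dots,m\}$, the inequality $$\lambda_1+\dots+\lambda_{|I|}+\sum_{j\in J}\lambda_{j+|I|}-\sum_{j\in J}\overline\lambda_j+\sum_{i\in I}\mu_i-\sum_{i\in I}\nu_i\ \ge\ 0$$ determines a facet of $\mathcal B_V$ if and only if $0<|I|+|J|<n+m$ and either (i) $|I|\ne 0,n$ (and $J$ is arbitrary), or (ii) $|I|=0$ and $|J|=1$, or (iii) $|I|=n$ and $|J|=m-1$. All these facets are different for different pairs $(I,J)$, and $\mathcal B_V$ has no other facets if $n=1$ or $(n,m)=(2,0)$. Otherwise the remaining facets are exactly those determined by the chamber inequalities $\lambda_j\ge\lambda_{j+1}$, $1\le j\le n+m-1$, and $\overline\lambda_{j}\ge\overline\lambda_{j+1}$, $1\le j\le m-1$ (none of the latter if $m\le 1$); each of these determines a facet, and different ones determine different facets. In particular, the number of facets of $\mathcal B_V$ is finite and equals $(2^n-2)2^m+n+4m-2$ if $n\ge 2$ and either $m\ge 1$ or $n=2$; it equals $2^n+n-3$ if $n\ge 3$ and $m=0$; and it equals $2m$ if $n=1$. -/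

import Mathlib

namespace StripConcave

/-- The index set `V` of trapezoidal arrays of size `(n, m)`:
pairs `ij` with `0 ≤ i ≤ n` and `0 ≤ j ≤ i + m`. -/
abbrev Node (n m : ℕ) : Type := {v : ℕ × ℕ // v.1 ≤ n ∧ v.2 ≤ v.1 + m}

/-- Trapezoidal arrays of size `(n, m)`, i.e. vectors in `ℝ^V`. -/
abbrev TrapArray (n m : ℕ) : Type := Node n m → ℝ

variable {n m : ℕ}

/-- The entry `x_{ij}` of an array. -/
def TrapArray.entry (X : TrapArray n m) (i j : ℕ) (h : i ≤ n ∧ j ≤ i + m) : ℝ :=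
  X ⟨(i, j), h⟩

/-- The row derivative `∂x_{ij} = x_{ij} - x_{i,j-1}`, for `0 ≤ i ≤ n` and `1 ≤ j ≤ i + m`. -/
def TrapArray.rowDeriv (X : TrapArray n m) (i j : ℕ) (h : i ≤ n ∧ 1 ≤ j ∧ j ≤ i + m) : ℝ :=
  X.entry i j ⟨h.1, h.2.2⟩ - X.entry i (j - 1) ⟨h.1, by omega⟩

/-- The cone of strip-concave arrays normalized by `x_{00} = 0`: the row derivative is a
Gelfand-Tsetlin pattern, `∂x_{ij} ≥ ∂x_{i-1,j} ≥ ∂x_{i,j+1}` for `1 ≤ i ≤ n` and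
`1 ≤ j ≤ i - 1 + m` (below `i` stands for `i - 1`). -/
def stripConcaveCone (n m : ℕ) : Set (TrapArray n m) :=
  {X | X.entry 0 0 ⟨by omega, by omega⟩ = 0 ∧
    ∀ (i j : ℕ) (hi : i < n) (hj : 1 ≤ j) (hjm : j ≤ i + m),
      X.rowDeriv i j ⟨by omega, by omega, by omega⟩ ≤
        X.rowDeriv (i + 1) j ⟨by omega, by omega, by omega⟩ ∧
      X.rowDeriv (i + 1) (j + 1) ⟨by omega, by omega, by omega⟩ ≤
        X.rowDeriv i j ⟨by omega, by omega, by omega⟩}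

/-- The space `ℝ^{n+m} × ℝ^m × ℝ^n × ℝ^n` of quadruples `(λ, λ̄, μ, ν)`.
Coordinates are numbered from `0` here: `q.lam j` is the entry `λ_{j+1}`, and so on. -/
abbrev Quadruple (n m : ℕ) : Type :=
  (Fin (n + m) → ℝ) × (Fin m → ℝ) × (Fin n → ℝ) × (Fin n → ℝ)

/-- The lower tuple `λ`. -/
def Quadruple.lam (q : Quadruple n m) : Fin (n + m) → ℝ := q.1

/-- The upper tuple `λ̄`. -/
def Quadruple.lamBar (q : Quadruple n m) : Fin m → ℝ := q.2.1

/-- The left tuple `μ`. -/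
def Quadruple.mu (q : Quadruple n m) : Fin n → ℝ := q.2.2.1

/-- The right tuple `ν`. -/
def Quadruple.nu (q : Quadruple n m) : Fin n → ℝ := q.2.2.2

/-- The quadruple `(λ^X, λ̄^X, μ^X, ν^X)` of local differences of `X` on the boundary:
`λ_j = ∂x_{nj}`, `λ̄_j = ∂x_{0j}`, `μ_i = x_{i,0} - x_{i-1,0}`,
`ν_i = x_{i,i+m} - x_{i-1,i-1+m}`. -/
def TrapArray.boundary (X : TrapArray n m) : Quadruple n m :=
  (fun j => X.rowDeriv n (j + 1) ⟨le_rfl, by omega, by omega⟩,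
   fun j => X.rowDeriv 0 (j + 1) ⟨by omega, by omega, by omega⟩,
   fun i => X.entry (i + 1) 0 ⟨by omega, by omega⟩ - X.entry i 0 ⟨by omega, by omega⟩,
   fun i => X.entry (i + 1) (i + 1 + m) ⟨by omega, by omega⟩ -
      X.entry i (i + m) ⟨by omega, by omega⟩)

/-- The cone `B_V` of feasible boundary quadruples: those that are the boundary quadruple of
at least one strip-concave array. -/
def boundaryCone (n m : ℕ) : Set (Quadruple n m) :=
  {q | ∃ X ∈ stripConcaveCone n m, X.boundary = q}

/-- The left-hand side `λ[1,|I|] + λ(J+|I|) - λ̄(J) + μ(I) - ν(I)` of the linearized Horn-type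
inequality for `(I, J)`. -/
def hornForm (I : Finset (Fin n)) (J : Finset (Fin m)) (q : Quadruple n m) : ℝ :=
  (∑ j with j.val < I.card, q.lam j)
    + (∑ j ∈ J, q.lam ⟨j + I.card, by have := card_finset_fin_le I; omega⟩)
    - (∑ j ∈ J, q.lamBar j) + (∑ i ∈ I, q.mu i) - ∑ i ∈ I, q.nu i

/-- The chamber inequalities `λ_j - λ_{j+1} ≥ 0`, `1 ≤ j ≤ n + m - 1` (left summand), and
`λ̄_j - λ̄_{j+1} ≥ 0`, `1 ≤ j ≤ m - 1` (right summand). For `m = 0` there are none of the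
latter. -/
def chamberForm : Fin (n + m - 1) ⊕ Fin (m - 1) → Quadruple n m → ℝ
  | Sum.inl j, q => q.lam ⟨j, by omega⟩ - q.lam ⟨j + 1, by omega⟩
  | Sum.inr j, q => q.lamBar ⟨j, by omega⟩ - q.lamBar ⟨j + 1, by omega⟩

/-- A facet of a convex polyhedron `C`: a nonempty exposed face (for polyhedra all faces are
exposed) whose dimension is one less than that of `C`. -/
def IsFacet {E : Type*} [AddCommGroup E] [Module ℝ E] [TopologicalSpace E] (C F : Set E) :
    Prop :=
  F.Nonempty ∧ IsExposed ℝ C F ∧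
    Module.finrank ℝ (vectorSpan ℝ F) + 1 = Module.finrank ℝ (vectorSpan ℝ C)

/-- The points of `C` at which the inequality `f ≥ 0` is an equality. -/
def tightSet {E : Type*} (C : Set E) (f : E → ℝ) : Set E := {x ∈ C | f x = 0}

/-- The inequality `f ≥ 0` determines a facet of `C`: it is valid on `C`, and the points of `C`
where it is tight form a facet. -/
def DeterminesFacet {E : Type*} [AddCommGroup E] [Module ℝ E] [TopologicalSpace E]
    (C : Set E) (f : E → ℝ) : Prop :=
  (∀ x ∈ C, 0 ≤ f x) ∧ IsFacet C (tightSet C f)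

/-- The condition on `(I, J)` in the list of facets: `0 < |I| + |J| < n + m`, and
`0 < |I| < n`, or `|I| = 0` and `|J| = 1`, or `|I| = n` and `|J| = m - 1`. -/
def IsEssential (I : Finset (Fin n)) (J : Finset (Fin m)) : Prop :=
  (0 < I.card + J.card ∧ I.card + J.card < n + m) ∧
    ((I.card ≠ 0 ∧ I.card ≠ n) ∨ (I.card = 0 ∧ J.card = 1) ∨ (I.card = n ∧ J.card + 1 = m))

/-- The sets of tight points of the linearized Horn-type inequalities for the pairs `(I, J)` in
the list of facets. -/
def hornFacets (n m : ℕ) : Set (Set (Quadruple n m)) :=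
  {F | ∃ (I : Finset (Fin n)) (J : Finset (Fin m)),
    IsEssential I J ∧ F = tightSet (boundaryCone n m) (hornForm I J)}

end StripConcave

/-!
Reading off `∂X` row by row, a strip-concave array is a skew Gelfand–Tsetlin pattern with first
row `λ̄` and last row `λ`, together with an arbitrary `μ`; the increments of its row sums are the
weight `w = ν - μ`. So `𝓑_V` is the cone of all `(λ, λ̄, μ, ν)` for which some pattern from `λ̄`
to `λ` has weight `ν - μ`.

*Inequalities.* The Horn-type inequalities hold for every pattern
(`IsPattern.sum_block_ge`). Conversely, for fixed `λ, λ̄` the set of weights is convex, and it is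
symmetric under permutations by the Bender–Knuth involutions (`comp_perm_mem_weightSet`). The
minimum over `J` of the Horn-type bounds for `|I| = k` is the sum of the first `k` entries of one
explicit weight (`extremeWeight_mem_weightSet`), so the Horn-type inequalities and the trace
equality `|λ| - |λ̄| + |μ| - |ν| = 0` say that `w` is majorized by this weight, and Rado's theorem
(`mem_convexHull_perm_of_majorized`) shows that `w` is attained (`mem_weightSet_of_horn`). Thus
`𝓑_V` is cut out of the trace hyperplane by the chamber and the Horn-type inequalities. For
`I = ∅` and for the full `I` the latter are sums of those for `|J| = 1`, resp. `|J| = m - 1`, and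
in the exceptional cases the chamber inequalities are such sums as well
(`boundaryCone_eq_subspaceCone`).

*Irredundance.* For each remaining inequality there is a point of the hyperplane at which it is
tight and all the others are strict (`exists_point_tight_horn`, `exists_point_tight_chamber`).
For a cone with such points the facets correspond bijectively to the inequalities
(`IsIrredundant.setOf_isFacet`), and a sum of several of the forms, or of none, does not determine
a facet (`not_isFacet_of_hornForm_eq_sum`). It remains to count the inequalities.
-/

namespace StripConcave

/-! ### Facets of an irredundantly presented cone -/

section Polyhedral

variable {E : Type*} [AddCommGroup E] [Module ℝ E]

/-- The cone cut out of the subspace `K` by finitely many linear inequalities. -/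
def subspaceCone {ι : Type*} (K : Submodule ℝ E) (a : ι → E →ₗ[ℝ] ℝ) : Set E :=
  {x | x ∈ K ∧ ∀ i, 0 ≤ a i x}

theorem exists_pos_forall_add_smul {ι : Type*} [Finite ι] (a : ι → E →ₗ[ℝ] ℝ) {p : E}
    (hp : ∀ i, 0 < a i p) (v : E) : ∃ ε : ℝ, 0 < ε ∧ ∀ i, 0 ≤ a i (p + ε • v) := by
  have h : ∀ᶠ ε in nhdsWithin (0 : ℝ) (Set.Ioi 0), ∀ i, 0 ≤ a i (p + ε • v) := by
    rw [Filter.eventually_all]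
    intro i
    have hc : Filter.Tendsto (fun ε : ℝ => a i (p + ε • v)) (nhds 0) (nhds (a i p)) := by
      have : Continuous fun ε : ℝ => a i p + ε * a i v := by fun_prop
      simpa using this.tendsto 0
    exact ((hc.mono_left nhdsWithin_le_nhds).eventually (lt_mem_nhds (hp i))).mono
      fun _ h => h.le
  obtain ⟨ε, h1, h2⟩ := (h.and self_mem_nhdsWithin).exists
  exact ⟨ε, h2, h1⟩

theorem vectorSpan_subspaceCone {ι : Type*} [Finite ι] (K : Submodule ℝ E)
    (a : ι → E →ₗ[ℝ] ℝ) {p : E} (hpK : p ∈ K) (hp : ∀ i, 0 < a i p) :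
    vectorSpan ℝ (subspaceCone K a) = K := by
  apply le_antisymm
  · rw [vectorSpan_def, Submodule.span_le]
    rintro _ ⟨x, hx, y, hy, rfl⟩
    exact K.sub_mem hx.1 hy.1
  · intro v hv
    obtain ⟨ε, hε, h⟩ := exists_pos_forall_add_smul a hp v
    have h1 : p + ε • v ∈ subspaceCone K a := ⟨K.add_mem hpK (K.smul_mem _ hv), h⟩
    have h2 : p ∈ subspaceCone K a := ⟨hpK, fun i => (hp i).le⟩
    have h3 := vsub_mem_vectorSpan ℝ h1 h2
    have h4 := (vectorSpan ℝ (subspaceCone K a)).smul_mem ε⁻¹ h3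
    simpa [smul_smul, hε.ne'] using h4

theorem finrank_inf_ker_add_one [FiniteDimensional ℝ E] (K : Submodule ℝ E) (f : E →ₗ[ℝ] ℝ)
    {p : E} (hpK : p ∈ K) (hp : f p ≠ 0) :
    Module.finrank ℝ (K ⊓ LinearMap.ker f : Submodule ℝ E) + 1 = Module.finrank ℝ K := by
  have h1 : Module.finrank ℝ (LinearMap.ker (f.domRestrict K)) + 1 = Module.finrank ℝ K := by
    apply Module.Dual.finrank_ker_add_one_of_ne_zero
    intro h
    exact hp (by simpa using LinearMap.congr_fun h ⟨p, hpK⟩)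
  have h2 : (LinearMap.ker (f.domRestrict K)).map K.subtype = K ⊓ LinearMap.ker f := by
    ext x
    simp only [Submodule.mem_map, LinearMap.mem_ker, LinearMap.domRestrict_apply,
      Submodule.subtype_apply, Subtype.exists, Submodule.mem_inf]
    aesop
  rw [← h1, ← h2, Submodule.finrank_map_subtype_eq]

theorem tightSet_subspaceCone {ι : Type*} (K : Submodule ℝ E) (a : ι → E →ₗ[ℝ] ℝ) (i : ι) :
    tightSet (subspaceCone K a) (a i) =
      subspaceCone (K ⊓ LinearMap.ker (a i)) (fun j : {j // j ≠ i} => a j) := by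
  ext x
  simp only [tightSet, subspaceCone, Set.mem_ofPred_eq, Submodule.mem_inf, LinearMap.mem_ker,
    Subtype.forall]
  constructor
  · rintro ⟨⟨h1, h2⟩, h3⟩
    exact ⟨⟨h1, h3⟩, fun j _ => h2 j⟩
  · rintro ⟨⟨h1, h3⟩, h2⟩
    refine ⟨⟨h1, fun j => ?_⟩, h3⟩
    by_cases hj : j = i
    · rw [hj, h3]
    · exact h2 j hj

/-- A certificate that the inequalities `a i ≥ 0` cut `K` irredundantly: an interior point, and
for each `i` a point at which only the `i`-th inequality is tight. -/
structure IsIrredundant {ι : Type*} (K : Submodule ℝ E) (a : ι → E →ₗ[ℝ] ℝ) : Prop where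
  exists_interior : ∃ p ∈ K, ∀ i, 0 < a i p
  exists_tight : ∀ i, ∃ p ∈ K, a i p = 0 ∧ ∀ j, j ≠ i → 0 < a j p

variable {ι : Type*} {K : Submodule ℝ E} {a : ι → E →ₗ[ℝ] ℝ}

theorem IsIrredundant.exists_mem_tightSet (h : IsIrredundant K a) (i : ι) :
    ∃ p ∈ tightSet (subspaceCone K a) (a i), ∀ j, j ≠ i → 0 < a j p := by
  obtain ⟨p, hpK, hp0, hp⟩ := h.exists_tight i
  refine ⟨p, ⟨⟨hpK, fun j => ?_⟩, hp0⟩, hp⟩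
  by_cases hj : j = i
  · rw [hj, hp0]
  · exact (hp j hj).le

theorem IsIrredundant.eq_of_tightSet_subset (h : IsIrredundant K a) {i j : ι}
    (hij : tightSet (subspaceCone K a) (a i) ⊆ tightSet (subspaceCone K a) (a j)) : i = j := by
  obtain ⟨p, hp, hp'⟩ := h.exists_mem_tightSet i
  by_contra hne
  exact (hp' j (Ne.symm hne)).ne' (hij hp).2

theorem IsIrredundant.injective_tightSet (h : IsIrredundant K a) :
    Function.Injective fun i => tightSet (subspaceCone K a) (a i) :=
  fun _ _ hij => h.eq_of_tightSet_subset (le_of_eq hij)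

variable [Finite ι]

theorem IsIrredundant.vectorSpan_tightSet (h : IsIrredundant K a) (i : ι) :
    vectorSpan ℝ (tightSet (subspaceCone K a) (a i)) = K ⊓ LinearMap.ker (a i) := by
  obtain ⟨p, hpK, hp0, hp⟩ := h.exists_tight i
  rw [tightSet_subspaceCone]
  exact vectorSpan_subspaceCone _ _ (p := p) ⟨hpK, hp0⟩ fun j => hp j j.2

variable [FiniteDimensional ℝ E] [TopologicalSpace E]

/-- Every facet is the tight set of one of the inequalities: otherwise the sum of suitable
points of the facet would be interior to the cone, and the exposing functional would be
constant on the cone. -/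
theorem IsIrredundant.exists_eq_of_isFacet (h : IsIrredundant K a) {F : Set E}
    (hF : IsFacet (subspaceCone K a) F) : ∃ i, F = tightSet (subspaceCone K a) (a i) := by
  obtain ⟨p₀, hp₀K, hp₀⟩ := h.exists_interior
  obtain ⟨hne, hexp, hdim⟩ := hF
  obtain ⟨l, hl⟩ := hexp hne
  rw [vectorSpan_subspaceCone K a hp₀K hp₀] at hdim
  have hC0 : (0 : E) ∈ subspaceCone K a := ⟨K.zero_mem, fun i => by simp⟩
  have hadd : ∀ x ∈ subspaceCone K a, ∀ y ∈ subspaceCone K a, x + y ∈ subspaceCone K a :=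
    fun x hx y hy => ⟨K.add_mem hx.1 hy.1, fun i => by
      rw [map_add]; exact add_nonneg (hx.2 i) (hy.2 i)⟩
  -- the maximum of `l` on the cone is `0`
  have hl0 : ∀ x ∈ F, l x = 0 := by
    intro x hx
    rw [hl] at hx
    have h1 := hx.2 0 hC0
    have h2 := hx.2 (x + x) (hadd x hx.1 x hx.1)
    rw [map_zero] at h1
    rw [map_add] at h2
    linarith
  obtain ⟨x₀, hx₀⟩ := hne
  have hlC : ∀ y ∈ subspaceCone K a, l y ≤ 0 := by
    intro y hy
    rw [← hl0 x₀ hx₀]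
    rw [hl] at hx₀
    exact hx₀.2 y hy
  have hFmem : ∀ x, x ∈ F ↔ x ∈ subspaceCone K a ∧ l x = 0 := by
    intro x
    refine ⟨fun hx => ⟨by rw [hl] at hx; exact hx.1, hl0 x hx⟩, fun hx => ?_⟩
    rw [hl]
    exact ⟨hx.1, fun y hy => hx.2 ▸ hlC y hy⟩
  have hspan : vectorSpan ℝ F ≤ LinearMap.ker (l : E →ₗ[ℝ] ℝ) := by
    rw [vectorSpan_def, Submodule.span_le]
    rintro _ ⟨x, hx, y, hy, rfl⟩
    simp [hl0 x hx, hl0 y hy]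
  have hne_l : ¬ K ≤ LinearMap.ker (l : E →ₗ[ℝ] ℝ) := by
    intro hK
    have : F = subspaceCone K a := by
      ext x
      exact ⟨fun hx => ((hFmem x).1 hx).1, fun hx => (hFmem x).2 ⟨hx, hK hx.1⟩⟩
    rw [this, vectorSpan_subspaceCone K a hp₀K hp₀] at hdim
    omega
  obtain ⟨i, hi⟩ : ∃ i, ∀ x ∈ F, a i x = 0 := by
    by_contra! hcon
    choose x hxF hx using hcon
    have : Fintype ι := Fintype.ofFinite ι
    have hs : ∀ s : Finset ι, ∑ i ∈ s, x i ∈ F := by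
      intro s
      refine Finset.sum_induction x (· ∈ F) (fun u v hu hv => ?_) ?_ fun i _ => hxF i
      · rw [hFmem] at hu hv ⊢
        exact ⟨hadd u hu.1 v hv.1, by rw [map_add, hu.2, hv.2, add_zero]⟩
      · exact (hFmem 0).2 ⟨hC0, map_zero l⟩
    have hsum := (hFmem _).1 (hs Finset.univ)
    have hpos : ∀ i, 0 < a i (∑ j, x j) := by
      intro i
      rw [map_sum]
      refine Finset.sum_pos' (fun j _ => ((hFmem _).1 (hxF j)).1.2 i) ⟨i, Finset.mem_univ i, ?_⟩
      exact lt_of_le_of_ne (((hFmem _).1 (hxF i)).1.2 i) (hx i).symm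
    apply hne_l
    intro v hv
    have key : ∀ u ∈ K, l u ≤ 0 := by
      intro u hu
      obtain ⟨ε, hε, h'⟩ := exists_pos_forall_add_smul a hpos u
      have := hlC _ ⟨K.add_mem hsum.1.1 (K.smul_mem ε hu), h'⟩
      rw [map_add, hsum.2, zero_add, map_smul, smul_eq_mul] at this
      exact nonpos_of_mul_nonpos_right this hε
    have h1 := key v hv
    have h2 := key (-v) (K.neg_mem hv)
    rw [map_neg] at h2
    exact le_antisymm h1 (by simpa using h2)
  refine ⟨i, ?_⟩
  have hsub : F ⊆ tightSet (subspaceCone K a) (a i) :=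
    fun x hx => ⟨((hFmem x).1 hx).1, hi x hx⟩
  have hspan_eq : vectorSpan ℝ F = K ⊓ LinearMap.ker (a i) := by
    rw [← h.vectorSpan_tightSet i]
    apply Submodule.eq_of_le_of_finrank_eq (vectorSpan_mono ℝ hsub)
    rw [h.vectorSpan_tightSet i]
    have := finrank_inf_ker_add_one K (a i) hp₀K (hp₀ i).ne'
    omega
  refine subset_antisymm hsub fun x hx => (hFmem x).2 ⟨hx.1, ?_⟩
  exact hspan (hspan_eq ▸ (⟨hx.1.1, hx.2⟩ : x ∈ K ⊓ LinearMap.ker (a i)))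

variable [IsTopologicalAddGroup E] [ContinuousSMul ℝ E] [T2Space E]

theorem IsIrredundant.isFacet_tightSet (h : IsIrredundant K a) (i : ι) :
    IsFacet (subspaceCone K a) (tightSet (subspaceCone K a) (a i)) := by
  obtain ⟨p₀, hp₀K, hp₀⟩ := h.exists_interior
  obtain ⟨p, hp, -⟩ := h.exists_mem_tightSet i
  refine ⟨⟨p, hp⟩, fun _ => ⟨-LinearMap.toContinuousLinearMap (a i), ?_⟩, ?_⟩
  · ext x
    simp only [tightSet, Set.mem_ofPred_eq, neg_apply,
      LinearMap.coe_toContinuousLinearMap', neg_le_neg_iff]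
    refine and_congr_right fun hx => ⟨fun h0 y hy => h0 ▸ hy.2 i, fun hy => ?_⟩
    exact le_antisymm (hp.2 ▸ hy p hp.1) (hx.2 i)
  · rw [h.vectorSpan_tightSet, vectorSpan_subspaceCone K a hp₀K hp₀]
    exact finrank_inf_ker_add_one K (a i) hp₀K (hp₀ i).ne'

theorem IsIrredundant.setOf_isFacet (h : IsIrredundant K a) :
    {F | IsFacet (subspaceCone K a) F} =
      Set.range fun i => tightSet (subspaceCone K a) (a i) := by
  ext F
  constructor
  · intro hF
    obtain ⟨i, rfl⟩ := h.exists_eq_of_isFacet hF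
    exact ⟨i, rfl⟩
  · rintro ⟨i, rfl⟩
    exact h.isFacet_tightSet i

end Polyhedral

/-! ### Rado's theorem on majorization -/

section Rado

theorem mul_sum_le_sum_mul_of_antitone {a d : ℕ → ℝ} {N : ℕ}
    (ha : ∀ i, i < N → a (i + 1) ≤ a i) (hd : ∀ k ≤ N, 0 ≤ ∑ i ∈ Finset.range k, d i) :
    a N * ∑ i ∈ Finset.range (N + 1), d i ≤ ∑ i ∈ Finset.range (N + 1), a i * d i := by
  induction N with
  | zero => simp
  | succ N ih =>
    have h1 := ih (fun i hi => ha i (by omega)) fun k hk => hd k (by omega)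
    have h2 := ha N (by omega)
    have h3 := hd (N + 1) le_rfl
    rw [Finset.sum_range_succ, Finset.sum_range_succ (fun i => a i * d i)]
    nlinarith

theorem sum_mul_nonneg_of_antitone {n : ℕ} {a d : Fin n → ℝ} (ha : Antitone a)
    (hd : ∀ k ≤ n, 0 ≤ ∑ i with i.val < k, d i) (hd0 : ∑ i, d i = 0) :
    0 ≤ ∑ i, a i * d i := by
  obtain _ | n := n
  · simp
  let a' : ℕ → ℝ := fun i => if h : i < n + 1 then a ⟨i, h⟩ else 0
  let d' : ℕ → ℝ := fun i => if h : i < n + 1 then d ⟨i, h⟩ else 0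
  have hd' : ∀ k ≤ n + 1, ∑ i ∈ Finset.range k, d' i = ∑ i : Fin (n + 1) with i.val < k, d i := by
    intro k hk
    refine Finset.sum_bij' (fun i hi => ⟨i, by simp at hi; omega⟩) (fun i _ => i.val) ?_ ?_ ?_ ?_ ?_
    · simp
    · simp
    · simp
    · simp
    · intro i hi
      have : i < n + 1 := by simp at hi; omega
      exact dif_pos this
  have h := mul_sum_le_sum_mul_of_antitone (a := a') (d := d') (N := n) (fun i hi => by
    have h1 : i < n + 1 := by omega
    have h2 : i + 1 < n + 1 := by omega
    simp only [a', h1, h2, dif_pos]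
    exact ha (by simp)) fun k hk => by rw [hd' k (by omega)]; exact hd k (by omega)
  rw [Finset.sum_range, Finset.sum_range] at h
  have ea : ∀ i : Fin (n + 1), a' i = a i := fun i => dif_pos i.2
  have ed : ∀ i : Fin (n + 1), d' i = d i := fun i => dif_pos i.2
  simpa only [ea, ed, hd0, mul_zero] using h

/-- **Rado's theorem**: a vector majorized by `δ` is a convex combination of the permutations
of `δ`. A separating linear form, sorted decreasingly, would contradict summation by parts. -/
theorem mem_convexHull_perm_of_majorized {n : ℕ} {δ w : Fin n → ℝ}
    (hle : ∀ I : Finset (Fin n), ∑ i ∈ I, w i ≤ ∑ i with i.val < I.card, δ i)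
    (heq : ∑ i, w i = ∑ i, δ i) :
    w ∈ convexHull ℝ (Set.range fun σ : Equiv.Perm (Fin n) => δ ∘ σ) := by
  by_contra hw
  obtain ⟨f, u, hf, hu⟩ := geometric_hahn_banach_closed_point (convex_convexHull ℝ _)
    ((Set.finite_range fun σ : Equiv.Perm (Fin n) => δ ∘ σ).isClosed_convexHull ℝ) hw
  let c : Fin n → ℝ := fun i => f (Pi.single i 1)
  have hfc : ∀ x, f x = ∑ i, c i * x i := by
    intro x
    conv_lhs => rw [pi_eq_sum_univ' x, map_sum]
    refine Finset.sum_congr rfl fun i _ => ?_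
    rw [map_smul, smul_eq_mul, mul_comm]
  let σ : Equiv.Perm (Fin n) := Tuple.sort fun i => -c i
  have hσ : Antitone (c ∘ σ) := fun i j hij => by
    simpa using Tuple.monotone_sort (fun i => -c i) hij
  have h1 := hf _ (subset_convexHull ℝ _ ⟨σ.symm, rfl⟩)
  rw [hfc, ← Equiv.sum_comp σ] at h1
  rw [hfc, ← Equiv.sum_comp σ] at hu
  have h2 := sum_mul_nonneg_of_antitone (d := fun i => δ i - w (σ i)) hσ
    (fun k hk => by
      have h3 := hle ((Finset.univ.filter fun i : Fin n => i.val < k).map σ.toEmbedding)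
      rw [Finset.sum_map, Finset.card_map, Fin.card_filter_val_lt, min_eq_right hk] at h3
      rw [Finset.sum_sub_distrib]
      simpa using h3)
    (by rw [Finset.sum_sub_distrib, Equiv.sum_comp σ w, heq, sub_self])
  simp only [Function.comp_apply, Equiv.symm_apply_apply, mul_sub, Finset.sum_sub_distrib] at h1 h2
  linarith

end Rado

/-! ### Skew Gelfand–Tsetlin patterns and their weights -/

section Patterns

/-- A skew Gelfand–Tsetlin pattern with rows `r 0, …, r n`, the row `r i` having the entries
`r i 0, …, r i (i + m - 1)`; the values of `r` outside of this range are irrelevant. -/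
structure IsPattern (n m : ℕ) (r : ℕ → ℕ → ℝ) : Prop where
  le_succ : ∀ i < n, ∀ j < i + m, r i j ≤ r (i + 1) j
  succ_le : ∀ i < n, ∀ j < i + m, r (i + 1) (j + 1) ≤ r i j

/-- The sum of the `i + m` entries of the `i`-th row. -/
def rowSum (m : ℕ) (r : ℕ → ℕ → ℝ) (i : ℕ) : ℝ := ∑ j ∈ Finset.range (i + m), r i j

variable {n m : ℕ}

/-- The first `k` indices, followed by the indices of `J` shifted by `k`. -/
def block (k : ℕ) (J : Finset ℕ) : Finset ℕ := Finset.range k ∪ J.map (addRightEmbedding k)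

theorem sum_block (k : ℕ) (J : Finset ℕ) (f : ℕ → ℝ) :
    ∑ j ∈ block k J, f j = ∑ j ∈ Finset.range k, f j + ∑ j ∈ J, f (j + k) := by
  rw [block, Finset.sum_union, Finset.sum_map]
  · rfl
  · rw [Finset.disjoint_left]
    intro a ha hb
    simp only [Finset.mem_range, Finset.mem_map, addRightEmbedding_apply] at ha hb
    omega

theorem block_subset_range {k i : ℕ} (hk : k ≤ i) {J : Finset ℕ} (hJ : J ⊆ Finset.range m) :
    block k J ⊆ Finset.range (i + m) := by
  intro a ha
  simp only [block, Finset.mem_union, Finset.mem_range, Finset.mem_map,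
    addRightEmbedding_apply] at ha ⊢
  rcases ha with ha | ⟨b, hb, rfl⟩
  · omega
  · have := Finset.mem_range.1 (hJ hb)
    omega

theorem rowSum_succ_eq (r : ℕ → ℕ → ℝ) (i : ℕ) :
    rowSum m r (i + 1) = r (i + 1) 0 + ∑ j ∈ Finset.range (i + m), r (i + 1) (j + 1) := by
  rw [rowSum, show i + 1 + m = i + m + 1 by ring, Finset.sum_range_succ', add_comm]

/-- The Horn-type inequalities hold for patterns: going down one row, the block of entries
either keeps its place and the entries grow, or is extended by one, in which case its complement
is shifted by one and the entries of the complement decrease. -/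
theorem IsPattern.sum_block_ge {r : ℕ → ℕ → ℝ} (hr : IsPattern n m r) (I : Finset ℕ)
    {J : Finset ℕ} (hJ : J ⊆ Finset.range m) {i : ℕ} (hi : i ≤ n) :
    ∑ j ∈ J, r 0 j + ∑ t ∈ Finset.range i with t ∈ I, (rowSum m r (t + 1) - rowSum m r t) ≤
      ∑ j ∈ block ((Finset.range i).filter (· ∈ I)).card J, r i j := by
  induction i with
  | zero => simp [sum_block]
  | succ i ih =>
    refine le_trans ?_ (le_trans (add_le_add_left (ih (by omega))
      (if i ∈ I then rowSum m r (i + 1) - rowSum m r i else 0)) ?_)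
    · rw [Finset.range_add_one, Finset.filter_insert]
      split_ifs
      · rw [Finset.sum_insert (by simp)]
        linarith
      · simp
    · have hk : ((Finset.range i).filter (· ∈ I)).card ≤ i := by
        simpa using Finset.card_filter_le (Finset.range i) (· ∈ I)
      rw [Finset.range_add_one, Finset.filter_insert]
      split_ifs
      · rw [Finset.card_insert_of_notMem (by simp)]
        set k := ((Finset.range i).filter (· ∈ I)).card
        have h1 : ∑ j ∈ Finset.range (i + m), (r (i + 1) (j + 1) - r i j) ≤
            ∑ j ∈ block k J, (r (i + 1) (j + 1) - r i j) := by
          rw [← Finset.sum_sdiff (block_subset_range hk hJ)]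
          have : ∑ j ∈ Finset.range (i + m) \ block k J, (r (i + 1) (j + 1) - r i j) ≤ 0 :=
            Finset.sum_nonpos fun j hj => by
              have := hr.succ_le i (by omega) j
                (Finset.mem_range.1 (Finset.mem_sdiff.1 hj).1)
              linarith
          linarith
        rw [Finset.sum_sub_distrib, Finset.sum_sub_distrib, sum_block k J fun j =>
          r (i + 1) (j + 1)] at h1
        rw [sum_block (k + 1), Finset.sum_range_succ', rowSum_succ_eq]
        simp only [rowSum, ← add_assoc] at h1 ⊢
        linarith
      · rw [add_zero]
        exact Finset.sum_le_sum fun j hj => hr.le_succ i (by omega) j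
          (Finset.mem_range.1 (block_subset_range hk hJ hj))

/-- The weights of the skew Gelfand–Tsetlin patterns with first row `B` and last row `L`. -/
def weightSet (n m : ℕ) (L B : ℕ → ℝ) : Set (Fin n → ℝ) :=
  {w | ∃ r, IsPattern n m r ∧ (∀ j < n + m, r n j = L j) ∧ (∀ j < m, r 0 j = B j) ∧
    ∀ i : Fin n, w i = rowSum m r (i + 1) - rowSum m r i}

theorem convex_weightSet (L B : ℕ → ℝ) : Convex ℝ (weightSet n m L B) := by
  rintro w ⟨r, hr, hL, hB, hw⟩ w' ⟨r', hr', hL', hB', hw'⟩ a b ha hb hab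
  refine ⟨fun i j => a * r i j + b * r' i j, ⟨fun i hi j hj => ?_, fun i hi j hj => ?_⟩,
    fun j hj => ?_, fun j hj => ?_, fun i => ?_⟩
  · exact add_le_add (mul_le_mul_of_nonneg_left (hr.le_succ i hi j hj) ha)
      (mul_le_mul_of_nonneg_left (hr'.le_succ i hi j hj) hb)
  · exact add_le_add (mul_le_mul_of_nonneg_left (hr.succ_le i hi j hj) ha)
      (mul_le_mul_of_nonneg_left (hr'.succ_le i hi j hj) hb)
  · simp only
    rw [hL j hj, hL' j hj, ← add_mul, hab, one_mul]
  · simp only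
    rw [hB j hj, hB' j hj, ← add_mul, hab, one_mul]
  · simp only [Pi.add_apply, Pi.smul_apply, smul_eq_mul, hw, hw', rowSum,
      Finset.sum_add_distrib, ← Finset.mul_sum]
    ring

/-- The Bender–Knuth involution on a single row: each entry of the middle row `q` varies in an
interval whose ends are determined by the neighbouring rows `p` and `s`; reflect it in the
midpoint of this interval. -/
theorem exists_reflected_row {N : ℕ} {p q s : ℕ → ℝ} (h1 : ∀ j < N, p j ≤ q j)
    (h2 : ∀ j < N, q (j + 1) ≤ p j) (h3 : ∀ j < N + 1, q j ≤ s j)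
    (h4 : ∀ j < N + 1, s (j + 1) ≤ q j) :
    ∃ q' : ℕ → ℝ, (∀ j < N, p j ≤ q' j) ∧ (∀ j < N, q' (j + 1) ≤ p j) ∧
      (∀ j < N + 1, q' j ≤ s j) ∧ (∀ j < N + 1, s (j + 1) ≤ q' j) ∧
      ∑ j ∈ Finset.range (N + 1), q' j + ∑ j ∈ Finset.range (N + 1), q j =
        ∑ j ∈ Finset.range N, p j + ∑ j ∈ Finset.range (N + 2), s j := by
  let hi : ℕ → ℝ := fun j => Nat.casesOn j (s 0) fun j => min (s (j + 1)) (p j)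
  let lo : ℕ → ℝ := fun j => if j < N then max (s (j + 1)) (p j) else s (j + 1)
  have hhi : ∀ j < N + 1, q j ≤ hi j := by
    rintro (_ | j) hj
    · exact h3 0 hj
    · exact le_min (h3 _ hj) (h2 j (by omega))
  have hlo : ∀ j < N + 1, lo j ≤ q j := by
    intro j hj
    by_cases h : j < N
    · simp only [lo, if_pos h]
      exact max_le (h4 j hj) (h1 j h)
    · simp only [lo, if_neg h]
      exact h4 j hj
  refine ⟨fun j => lo j + hi j - q j, fun j hj => ?_, fun j hj => ?_, fun j hj => ?_,
    fun j hj => ?_, ?_⟩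
  · have : p j ≤ lo j := by simp [lo, hj]
    have := hhi j (by omega)
    linarith
  · have : hi (j + 1) ≤ p j := min_le_right _ _
    have := hlo (j + 1) (by omega)
    linarith
  · have : hi j ≤ s j := by
      cases j with
      | zero => exact le_rfl
      | succ j => exact min_le_left _ _
    have := hlo j hj
    linarith
  · have : s (j + 1) ≤ lo j := by
      simp only [lo]
      split_ifs
      · exact le_max_left _ _
      · exact le_rfl
    have := hhi j hj
    linarith
  · rw [← Finset.sum_add_distrib]
    simp only [sub_add_cancel, Finset.sum_add_distrib]
    rw [Finset.sum_range_succ lo, Finset.sum_range_succ' hi, Finset.sum_range_succ s,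
      Finset.sum_range_succ' s]
    have e1 : ∑ j ∈ Finset.range N, lo j = ∑ j ∈ Finset.range N, max (s (j + 1)) (p j) :=
      Finset.sum_congr rfl fun j hj => if_pos (Finset.mem_range.1 hj)
    have e2 : lo N = s (N + 1) := if_neg (lt_irrefl N)
    have e3 : ∑ j ∈ Finset.range N, max (s (j + 1)) (p j) +
        ∑ j ∈ Finset.range N, min (s (j + 1)) (p j) =
        ∑ j ∈ Finset.range N, s (j + 1) + ∑ j ∈ Finset.range N, p j := by
      rw [← Finset.sum_add_distrib, ← Finset.sum_add_distrib]
      exact Finset.sum_congr rfl fun j _ => max_add_min _ _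
    have e4 : ∑ j ∈ Finset.range N, hi (j + 1) =
        ∑ j ∈ Finset.range N, min (s (j + 1)) (p j) := rfl
    have e5 : hi 0 = s 0 := rfl
    linarith

theorem comp_swap_mem_weightSet {N : ℕ} {L B : ℕ → ℝ} {w : Fin (N + 1) → ℝ}
    (hw : w ∈ weightSet (N + 1) m L B) (i : Fin N) :
    w ∘ Equiv.swap i.castSucc i.succ ∈ weightSet (N + 1) m L B := by
  obtain ⟨r, hr, hL, hB, hw⟩ := hw
  obtain ⟨i, hi⟩ := i
  have e : i + m + 1 = i + 1 + m := by ring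
  have e' : i + m + 2 = i + 2 + m := by ring
  obtain ⟨q, h1, h2, h3, h4, hsum⟩ := exists_reflected_row (N := i + m) (p := r i)
    (q := r (i + 1)) (s := r (i + 2)) (hr.le_succ i (by omega)) (hr.succ_le i (by omega))
    (e ▸ hr.le_succ (i + 1) (by omega)) (e ▸ hr.succ_le (i + 1) (by omega))
  rw [e] at h3 h4 hsum
  rw [e'] at hsum
  have hne : ∀ {a}, a ≠ i + 1 → Function.update r (i + 1) q a = r a :=
    fun h => Function.update_of_ne h _ _
  have hself : Function.update r (i + 1) q (i + 1) = q := Function.update_self _ _ _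
  refine ⟨Function.update r (i + 1) q, ⟨fun a ha j hj => ?_, fun a ha j hj => ?_⟩,
    fun j hj => ?_, fun j hj => ?_, fun a => ?_⟩
  · rcases eq_or_ne a i with rfl | h
    · rw [hself, hne (by omega)]
      exact h1 j hj
    rcases eq_or_ne a (i + 1) with rfl | h'
    · rw [hself, hne (by omega)]
      exact h3 j hj
    rw [hne h', hne (by omega)]
    exact hr.le_succ a ha j hj
  · rcases eq_or_ne a i with rfl | h
    · rw [hself, hne (by omega)]
      exact h2 j hj
    rcases eq_or_ne a (i + 1) with rfl | h'
    · rw [hself, hne (by omega)]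
      exact h4 j hj
    rw [hne h', hne (by omega)]
    exact hr.succ_le a ha j hj
  · rw [hne (by omega)]
    exact hL j hj
  · rw [hne (by omega)]
    exact hB j hj
  · have hs : ∀ {b}, b ≠ i + 1 → rowSum m (Function.update r (i + 1) q) b = rowSum m r b :=
      fun h => by simp only [rowSum, hne h]
    have hs' : rowSum m (Function.update r (i + 1) q) (i + 1) =
        rowSum m r i + rowSum m r (i + 2) - rowSum m r (i + 1) := by
      simp only [rowSum, hself]
      linarith
    rw [Function.comp_apply, hw]
    obtain ⟨a, ha⟩ := a
    rcases eq_or_ne a i with rfl | h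
    · have : Equiv.swap (Fin.castSucc ⟨a, hi⟩) (Fin.succ ⟨a, hi⟩) ⟨a, ha⟩ = ⟨a + 1, by omega⟩ :=
        Equiv.swap_apply_left _ _
      rw [this]
      simp only [hs', hs (show a ≠ a + 1 by omega)]
      ring
    rcases eq_or_ne a (i + 1) with rfl | h'
    · have : Equiv.swap (Fin.castSucc ⟨i, hi⟩) (Fin.succ ⟨i, hi⟩) ⟨i + 1, ha⟩ =
          ⟨i, by omega⟩ := Equiv.swap_apply_right _ _
      rw [this]
      simp only [hs', hs (show i + 1 + 1 ≠ i + 1 by omega)]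
      ring
    · rw [Equiv.swap_apply_of_ne_of_ne (by simpa [Fin.ext_iff] using h)
        (by simpa [Fin.ext_iff] using h')]
      simp only [hs h', hs (show a + 1 ≠ i + 1 by omega)]

theorem comp_perm_mem_weightSet {L B : ℕ → ℝ} {w : Fin n → ℝ}
    (hw : w ∈ weightSet n m L B) (σ : Equiv.Perm (Fin n)) : w ∘ σ ∈ weightSet n m L B := by
  obtain _ | N := n
  · rwa [Subsingleton.elim (w ∘ σ) w]
  have hσ : σ ∈ Submonoid.closure (Set.range fun i : Fin N => Equiv.swap i.castSucc i.succ) := by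
    rw [Equiv.Perm.mclosure_swap_castSucc_succ]
    trivial
  induction hσ using Submonoid.closure_induction generalizing w with
  | mem σ h =>
    obtain ⟨i, rfl⟩ := h
    exact comp_swap_mem_weightSet hw i
  | one => exact hw
  | mul σ τ _ _ h1 h2 => exact h2 (h1 hw)

/-- The partial sums of the extreme weight of the patterns with first row `B` and last row `L`:
the minimum over `J` of the terms of the Horn-type inequality for `(I, J)`, `|I| = k`, that do
not involve the weight. -/
def extremeSum (m : ℕ) (L B : ℕ → ℝ) (k : ℕ) : ℝ :=
  ∑ j ∈ Finset.range k, L j + ∑ j ∈ Finset.range m, (min (B j) (L (k + j)) - B j)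

/-- The extreme weight is attained by the pattern whose `k`-th row consists of the first `k`
entries of `L` followed by the entrywise minimum of `B` and the shift of `L` by `k`. -/
theorem extremeWeight_mem_weightSet {L B : ℕ → ℝ} (hL : ∀ j, j + 1 < n + m → L (j + 1) ≤ L j)
    (hB : ∀ j, j + 1 < m → B (j + 1) ≤ B j) (h0 : ∀ j < m, B j ≤ L j)
    (hn : ∀ j < m, L (n + j) ≤ B j) :
    (fun i : Fin n => extremeSum m L B (i + 1) - extremeSum m L B i) ∈ weightSet n m L B := by
  refine ⟨fun k j => if j < k then L j else min (B (j - k)) (L j),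
    ⟨fun i hi j hj => ?_, fun i hi j hj => ?_⟩, fun j hj => ?_, fun j hj => ?_, fun i => ?_⟩
  · rcases lt_trichotomy j i with h | rfl | h
    · rw [if_pos h, if_pos (by omega)]
    · rw [if_neg (lt_irrefl _), if_pos (by omega)]
      exact min_le_right _ _
    · rw [if_neg (by omega), if_neg (by omega)]
      refine min_le_min_right _ ?_
      have := hB (j - (i + 1)) (by omega)
      rwa [show j - (i + 1) + 1 = j - i by omega] at this
  · by_cases h : j < i
    · rw [if_pos h, if_pos (by omega)]
      exact hL j (by omega)
    · rw [if_neg h, if_neg (by omega), Nat.add_sub_add_right]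
      exact min_le_min_left _ (hL j (by omega))
  · simp only
    split_ifs with h
    · rfl
    · have := hn (j - n) (by omega)
      rw [show n + (j - n) = j by omega] at this
      exact min_eq_right this
  · simpa using h0 j hj
  · have key : ∀ k, rowSum m (fun k j => if j < k then L j else min (B (j - k)) (L j)) k =
        extremeSum m L B k + ∑ j ∈ Finset.range m, B j := by
      intro k
      rw [rowSum, extremeSum, Finset.sum_range_add, Finset.sum_sub_distrib]
      have e1 : ∑ j ∈ Finset.range k, (if j < k then L j else min (B (j - k)) (L j)) =
          ∑ j ∈ Finset.range k, L j :=
        Finset.sum_congr rfl fun j hj => if_pos (Finset.mem_range.1 hj)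
      have e2 : ∑ j ∈ Finset.range m,
          (if k + j < k then L (k + j) else min (B (k + j - k)) (L (k + j))) =
          ∑ j ∈ Finset.range m, min (B j) (L (k + j)) :=
        Finset.sum_congr rfl fun j _ => by
          rw [if_neg (by omega), Nat.add_sub_cancel_left]
      rw [e1, e2]
      ring
    rw [key, key]
    ring

/-- The Horn-type inequalities and the trace equality suffice for the existence of a pattern:
the weight is then majorized by the extreme weight, hence a convex combination of permutations
of it, and the set of weights is convex and symmetric. -/
theorem mem_weightSet_of_horn {L B : ℕ → ℝ} {w : Fin n → ℝ}
    (hL : ∀ j, j + 1 < n + m → L (j + 1) ≤ L j) (hB : ∀ j, j + 1 < m → B (j + 1) ≤ B j)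
    (htr : ∑ i, w i = ∑ j ∈ Finset.range (n + m), L j - ∑ j ∈ Finset.range m, B j)
    (hH : ∀ (I : Finset (Fin n)) (J : Finset ℕ), J ⊆ Finset.range m →
      ∑ i ∈ I, w i ≤ ∑ j ∈ Finset.range I.card, L j + ∑ j ∈ J, (L (I.card + j) - B j)) :
    w ∈ weightSet n m L B := by
  have h0 : ∀ j < m, B j ≤ L j := by
    intro j hj
    simpa using hH ∅ {j} (by simpa using hj)
  have hn : ∀ j < m, L (n + j) ≤ B j := by
    intro j hj
    have h := hH Finset.univ ((Finset.range m).erase j) (Finset.erase_subset _ _)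
    rw [htr, Finset.card_univ, Fintype.card_fin, Finset.sum_range_add] at h
    have h2 := Finset.add_sum_erase (Finset.range m) (fun j => L (n + j) - B j)
      (Finset.mem_range.2 hj)
    have h3 := Finset.sum_sub_distrib (s := Finset.range m) (fun j => L (n + j)) B
    linarith
  have hF0 : extremeSum m L B 0 = 0 := by
    simp only [extremeSum, Finset.sum_range_zero, zero_add]
    exact Finset.sum_eq_zero fun j hj => by
      rw [min_eq_left (h0 j (Finset.mem_range.1 hj)), sub_self]
  have hFn : extremeSum m L B n =
      ∑ j ∈ Finset.range (n + m), L j - ∑ j ∈ Finset.range m, B j := by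
    have : ∑ j ∈ Finset.range m, (min (B j) (L (n + j)) - B j) =
        ∑ j ∈ Finset.range m, (L (n + j) - B j) :=
      Finset.sum_congr rfl fun j hj => by rw [min_eq_right (hn j (Finset.mem_range.1 hj))]
    rw [extremeSum, this, Finset.sum_range_add, Finset.sum_sub_distrib]
    ring
  have hF : ∀ k ≤ n, ∑ i : Fin n with i.val < k,
      (extremeSum m L B (i + 1) - extremeSum m L B i) = extremeSum m L B k := by
    intro k hk
    rw [← sub_zero (extremeSum m L B k), ← hF0, ← Finset.sum_range_sub]
    refine Finset.sum_bij' (fun i _ => i.val)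
      (fun i hi => ⟨i, by have := Finset.mem_range.1 hi; omega⟩) ?_ ?_ ?_ ?_ ?_ <;> simp
  have hmaj := mem_convexHull_perm_of_majorized (w := w)
    (δ := fun i => extremeSum m L B (i + 1) - extremeSum m L B i) (fun I => by
      rw [hF _ (card_finset_fin_le I)]
      refine (hH I ((Finset.range m).filter fun j => L (I.card + j) < B j)
        (Finset.filter_subset _ _)).trans (le_of_eq ?_)
      rw [extremeSum, Finset.sum_filter]
      congr 1
      refine Finset.sum_congr rfl fun j _ => ?_
      split_ifs with h
      · rw [min_eq_right h.le]
      · rw [min_eq_left (not_lt.1 h), sub_self]) (by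
      rw [htr, ← hFn, ← hF n le_rfl]
      refine (Finset.sum_congr ?_ fun _ _ => rfl).symm
      ext i
      simp)
  refine convexHull_min ?_ (convex_weightSet L B) hmaj
  rintro _ ⟨σ, rfl⟩
  exact comp_perm_mem_weightSet (extremeWeight_mem_weightSet hL hB h0 hn) σ

end Patterns

/-! ### The inequalities describing the boundary cone -/

section Description

variable {n m : ℕ}

/-- Extension of a finite sequence by zero. -/
def extendZero {N : ℕ} (v : Fin N → ℝ) (j : ℕ) : ℝ := if h : j < N then v ⟨j, h⟩ else 0

theorem extendZero_val {N : ℕ} (v : Fin N → ℝ) (j : Fin N) : extendZero v j = v j := dif_pos j.2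

theorem mem_weightSet_of_mem_boundaryCone {q : Quadruple n m} (hq : q ∈ boundaryCone n m) :
    (fun i => q.nu i - q.mu i) ∈ weightSet n m (extendZero q.lam) (extendZero q.lamBar) := by
  obtain ⟨X, ⟨-, hX⟩, rfl⟩ := hq
  let x : ℕ → ℕ → ℝ := fun i j => if h : i ≤ n ∧ j ≤ i + m then X ⟨(i, j), h⟩ else 0
  have hx : ∀ {i j} (h : i ≤ n ∧ j ≤ i + m), x i j = X.entry i j h := fun h => dif_pos h
  have hr : ∀ {i j} (hi : i ≤ n) (hj : j < i + m),
      x i (j + 1) - x i j = X.rowDeriv i (j + 1) ⟨hi, by omega, by omega⟩ := by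
    intro i j hi hj
    rw [hx ⟨hi, by omega⟩, hx ⟨hi, by omega⟩]
    rfl
  have hsum : ∀ i, rowSum m (fun i j => x i (j + 1) - x i j) i = x i (i + m) - x i 0 :=
    fun i => Finset.sum_range_sub _ _
  refine ⟨fun i j => x i (j + 1) - x i j, ⟨fun i hi j hj => ?_, fun i hi j hj => ?_⟩,
    fun j hj => ?_, fun j hj => ?_, fun i => ?_⟩
  · rw [hr (by omega) hj, hr (by omega) (by omega)]
    exact (hX i (j + 1) hi (by omega) (by omega)).1
  · rw [hr (by omega) hj, hr (by omega) (by omega)]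
    exact (hX i (j + 1) hi (by omega) (by omega)).2
  · simp only
    rw [hr le_rfl hj]
    exact (extendZero_val X.boundary.lam ⟨j, hj⟩).symm
  · simp only
    rw [hr (by omega) (by omega)]
    exact (extendZero_val X.boundary.lamBar ⟨j, hj⟩).symm
  · rw [hsum, hsum, hx ⟨by omega, by omega⟩, hx ⟨by omega, by omega⟩, hx ⟨by omega, by omega⟩,
      hx ⟨by omega, by omega⟩]
    simp only [TrapArray.boundary, Quadruple.nu, Quadruple.mu]
    ring

theorem mem_boundaryCone_of_mem_weightSet {q : Quadruple n m}
    (hq : (fun i => q.nu i - q.mu i) ∈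
      weightSet n m (extendZero q.lam) (extendZero q.lamBar)) : q ∈ boundaryCone n m := by
  obtain ⟨r, hr, hL, hB, hw⟩ := hq
  let X : TrapArray n m := fun v =>
    ∑ t ∈ Finset.range v.1.1, extendZero q.mu t + ∑ t ∈ Finset.range v.1.2, r v.1.1 t
  have hX : ∀ i j h, X.rowDeriv i (j + 1) h = r i j := by
    intro i j h
    simp only [TrapArray.rowDeriv, TrapArray.entry, X, Nat.add_sub_cancel, Finset.sum_range_succ]
    ring
  refine ⟨X, ⟨by simp [TrapArray.entry, X], ?_⟩, Prod.ext ?_ (Prod.ext ?_ (Prod.ext ?_ ?_))⟩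
  · rintro i (_ | j) hi hj hjm
    · omega
    · rw [hX, hX, hX]
      exact ⟨hr.le_succ i hi j (by omega), hr.succ_le i hi j (by omega)⟩
  · ext j
    simp only [TrapArray.boundary]
    rw [hX, hL _ j.2]
    exact extendZero_val _ j
  · ext j
    simp only [TrapArray.boundary]
    rw [hX, hB _ j.2]
    exact extendZero_val _ j
  · ext i
    simp only [TrapArray.boundary, TrapArray.entry, X, Finset.sum_range_succ, extendZero_val]
    simp [Quadruple.mu]
  · ext i
    have := hw i
    simp only [rowSum] at this
    simp only [TrapArray.boundary, TrapArray.entry, X, Finset.sum_range_succ _ i.val,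
      extendZero_val]
    change _ = q.nu i
    linarith

/-- `hornForm` with the values of `λ` and `λ̄` given by sequences indexed by `ℕ`. -/
theorem hornForm_eq {q : Quadruple n m} {L B : ℕ → ℝ} (hL : ∀ j : Fin (n + m), q.lam j = L j)
    (hB : ∀ j : Fin m, q.lamBar j = B j) (I : Finset (Fin n)) (J : Finset (Fin m)) :
    hornForm I J q = ∑ j ∈ Finset.range I.card, L j + ∑ j ∈ J, (L (I.card + j) - B j) -
      ∑ i ∈ I, (q.nu i - q.mu i) := by
  have hI := card_finset_fin_le I
  have h1 : ∑ j : Fin (n + m) with j.val < I.card, L j = ∑ j ∈ Finset.range I.card, L j := by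
    refine Finset.sum_bij' (fun i _ => i.val)
      (fun i hi => ⟨i, by have := Finset.mem_range.1 hi; omega⟩) ?_ ?_ ?_ ?_ ?_ <;> simp
  simp only [hornForm, hL, hB, h1, Finset.sum_sub_distrib, add_comm I.card]
  ring

/-- The form `|λ| - |λ̄| + |μ| - |ν|`, which vanishes on the boundary cone. -/
def traceForm (n m : ℕ) : Quadruple n m →ₗ[ℝ] ℝ where
  toFun q := ∑ j, q.lam j - ∑ j, q.lamBar j + ∑ i, q.mu i - ∑ i, q.nu i
  map_add' q q' := by
    simp only [Quadruple.lam, Quadruple.lamBar, Quadruple.mu, Quadruple.nu, Prod.fst_add,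
      Prod.snd_add, Pi.add_apply, Finset.sum_add_distrib]
    ring
  map_smul' c q := by
    simp only [Quadruple.lam, Quadruple.lamBar, Quadruple.mu, Quadruple.nu, Prod.smul_fst,
      Prod.smul_snd, Pi.smul_apply, smul_eq_mul, ← Finset.mul_sum, RingHom.id_apply]
    ring

/-- `hornForm` as a linear form. -/
def hornLinear (I : Finset (Fin n)) (J : Finset (Fin m)) : Quadruple n m →ₗ[ℝ] ℝ where
  toFun := hornForm I J
  map_add' q q' := by
    simp only [hornForm, Quadruple.lam, Quadruple.lamBar, Quadruple.mu, Quadruple.nu,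
      Prod.fst_add, Prod.snd_add, Pi.add_apply, Finset.sum_add_distrib]
    ring
  map_smul' c q := by
    simp only [hornForm, Quadruple.lam, Quadruple.lamBar, Quadruple.mu, Quadruple.nu,
      Prod.smul_fst, Prod.smul_snd, Pi.smul_apply, smul_eq_mul, ← Finset.mul_sum,
      RingHom.id_apply]
    ring

/-- `chamberForm` as a linear form. -/
def chamberLinear (k : Fin (n + m - 1) ⊕ Fin (m - 1)) : Quadruple n m →ₗ[ℝ] ℝ where
  toFun := chamberForm k
  map_add' q q' := by
    cases k <;> simp only [chamberForm, Quadruple.lam, Quadruple.lamBar, Prod.fst_add,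
      Prod.snd_add, Pi.add_apply] <;> ring
  map_smul' c q := by
    cases k <;> simp only [chamberForm, Quadruple.lam, Quadruple.lamBar, Prod.smul_fst,
      Prod.smul_snd, Pi.smul_apply, smul_eq_mul, RingHom.id_apply] <;> ring

theorem traceForm_eq {q : Quadruple n m} {L B : ℕ → ℝ} (hL : ∀ j : Fin (n + m), q.lam j = L j)
    (hB : ∀ j : Fin m, q.lamBar j = B j) :
    traceForm n m q = ∑ j ∈ Finset.range (n + m), L j - ∑ j ∈ Finset.range m, B j -
      ∑ i, (q.nu i - q.mu i) := by
  rw [Finset.sum_range, Finset.sum_range]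
  simp only [traceForm, LinearMap.coe_mk, AddHom.coe_mk, hL, hB, Finset.sum_sub_distrib]
  ring

theorem sum_filter_val_mem {J : Finset ℕ} (hJ : J ⊆ Finset.range m) (f : ℕ → ℝ) :
    ∑ j : Fin m with j.val ∈ J, f j = ∑ j ∈ J, f j := by
  refine Finset.sum_bij' (fun i _ => i.val)
    (fun i hi => ⟨i, Finset.mem_range.1 (hJ hi)⟩) ?_ ?_ ?_ ?_ ?_ <;> simp

theorem mem_boundaryCone_of_nonneg {q : Quadruple n m} (htr : traceForm n m q = 0)
    (hc : ∀ k, 0 ≤ chamberForm k q) (hH : ∀ I J, 0 ≤ hornForm I J q) :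
    q ∈ boundaryCone n m := by
  have hL := fun j => (extendZero_val q.lam j).symm
  have hB := fun j => (extendZero_val q.lamBar j).symm
  apply mem_boundaryCone_of_mem_weightSet
  apply mem_weightSet_of_horn
  · intro j hj
    have := hc (Sum.inl ⟨j, by omega⟩)
    simpa [chamberForm, hL] using this
  · intro j hj
    have := hc (Sum.inr ⟨j, by omega⟩)
    simpa [chamberForm, hB] using this
  · rw [traceForm_eq hL hB] at htr
    linarith
  · intro I J hJ
    have := hH I (Finset.univ.filter fun j => j.val ∈ J)
    rw [hornForm_eq hL hB, sum_filter_val_mem hJ fun j =>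
      extendZero q.lam (I.card + j) - extendZero q.lamBar j] at this
    linarith

theorem traceForm_eq_zero {q : Quadruple n m} (hq : q ∈ boundaryCone n m) :
    traceForm n m q = 0 := by
  obtain ⟨r, hr, hL, hB, hw⟩ := mem_weightSet_of_mem_boundaryCone hq
  rw [traceForm_eq (fun j => (extendZero_val q.lam j).symm)
    fun j => (extendZero_val q.lamBar j).symm, Finset.sum_congr rfl fun i _ => hw i,
    ← Finset.sum_range fun i => rowSum m r (i + 1) - rowSum m r i, Finset.sum_range_sub, rowSum,
    rowSum, Finset.sum_congr rfl fun j hj => hL j (Finset.mem_range.1 hj), zero_add,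
    Finset.sum_congr rfl fun j hj => hB j (Finset.mem_range.1 hj)]
  ring

theorem chamberForm_nonneg (hn : 1 ≤ n) {q : Quadruple n m} (hq : q ∈ boundaryCone n m)
    (k : Fin (n + m - 1) ⊕ Fin (m - 1)) : 0 ≤ chamberForm k q := by
  obtain ⟨r, hr, hL, hB, -⟩ := mem_weightSet_of_mem_boundaryCone hq
  obtain ⟨n, rfl⟩ : ∃ n', n = n' + 1 := ⟨n - 1, by omega⟩
  rcases k with ⟨j, hj⟩ | ⟨j, hj⟩
  · simp only [chamberForm, ← extendZero_val q.lam]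
    rw [← hL _ (by omega), ← hL _ (by omega)]
    have h1 := hr.le_succ n (by omega) j (by omega)
    have h2 := hr.succ_le n (by omega) j (by omega)
    linarith
  · simp only [chamberForm, ← extendZero_val q.lamBar]
    rw [← hB _ (by omega), ← hB _ (by omega)]
    have h1 := hr.le_succ 0 (by omega) (j + 1) (by omega)
    have h2 := hr.succ_le 0 (by omega) j (by omega)
    linarith

theorem hornForm_nonneg {q : Quadruple n m} (hq : q ∈ boundaryCone n m) (I : Finset (Fin n))
    (J : Finset (Fin m)) : 0 ≤ hornForm I J q := by
  obtain ⟨r, hr, hL, hB, hw⟩ := mem_weightSet_of_mem_boundaryCone hq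
  have hI : (Finset.range n).filter (· ∈ I.map Fin.valEmbedding) = I.map Fin.valEmbedding := by
    ext i
    simp only [Finset.mem_filter, Finset.mem_range, Finset.mem_map, Fin.valEmbedding_apply]
    refine ⟨fun h => h.2, fun h => ⟨?_, h⟩⟩
    obtain ⟨a, -, rfl⟩ := h
    exact a.2
  have h := hr.sum_block_ge (I.map Fin.valEmbedding) (J := J.map Fin.valEmbedding) (fun j hj => by
    obtain ⟨a, -, rfl⟩ := Finset.mem_map.1 hj
    exact Finset.mem_range.2 a.2) le_rfl
  rw [hI, sum_block, Finset.sum_map, Finset.sum_map, Finset.sum_map, Finset.card_map] at h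
  have hIn := card_finset_fin_le I
  rw [hornForm_eq (fun j => (extendZero_val q.lam j).symm)
    fun j => (extendZero_val q.lamBar j).symm, Finset.sum_congr rfl fun i _ => hw i,
    Finset.sum_sub_distrib,
    Finset.sum_congr rfl fun j hj => (hL j (by have := Finset.mem_range.1 hj; omega)).symm,
    Finset.sum_congr rfl fun j (_ : j ∈ J) => (hL (I.card + j) (by omega)).symm,
    Finset.sum_congr rfl fun j (_ : j ∈ J) => (hB j (by omega)).symm]
  simp only [Fin.valEmbedding_apply, add_comm _ I.card] at h
  linarith

theorem hornForm_empty (J : Finset (Fin m)) (q : Quadruple n m) :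
    hornForm ∅ J q = ∑ j ∈ J, hornForm ∅ {j} q := by
  simp [hornForm, Finset.sum_sub_distrib]

theorem hornForm_univ_eq (J : Finset (Fin m)) (q : Quadruple n m) :
    hornForm Finset.univ J q = traceForm n m q +
      ∑ j ∈ Jᶜ, (extendZero q.lamBar j - extendZero q.lam (n + j)) := by
  have hL := fun j => (extendZero_val q.lam j).symm
  have hB := fun j => (extendZero_val q.lamBar j).symm
  rw [hornForm_eq hL hB, traceForm_eq hL hB, Finset.card_univ, Fintype.card_fin,
    Finset.sum_range_add, Finset.sum_range (n := m), Finset.sum_range (n := m),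
    ← Finset.sum_add_sum_compl J fun j => extendZero q.lam (n + j),
    ← Finset.sum_add_sum_compl J fun j => extendZero q.lamBar j, Finset.sum_sub_distrib _ _ (s := J),
    Finset.sum_sub_distrib _ _ (s := Jᶜ)]
  ring

theorem hornForm_univ {q : Quadruple n m} (hq : traceForm n m q = 0) (J : Finset (Fin m)) :
    hornForm Finset.univ J q = ∑ j ∈ Jᶜ, hornForm Finset.univ {j}ᶜ q := by
  simp [hornForm_univ_eq, hq]

theorem isEssential_empty_singleton (hn : 1 ≤ n) (j : Fin m) :
    IsEssential (∅ : Finset (Fin n)) {j} := by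
  have := j.2
  exact ⟨by rw [Finset.card_empty, Finset.card_singleton]; omega,
    Or.inr (Or.inl ⟨Finset.card_empty, Finset.card_singleton j⟩)⟩

theorem isEssential_univ_compl_singleton (hn : 1 ≤ n) (j : Fin m) :
    IsEssential (Finset.univ : Finset (Fin n)) {j}ᶜ := by
  have := j.2
  have hJ : ({j}ᶜ : Finset (Fin m)).card + 1 = m := by
    rw [Finset.card_compl, Finset.card_singleton, Fintype.card_fin]
    omega
  exact ⟨by rw [Finset.card_univ, Fintype.card_fin]; omega, Or.inr (Or.inr ⟨by simp, hJ⟩)⟩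

/-- The essential Horn-type inequalities imply all others: for `I = ∅` and for `I` the whole
index set the inequality is a sum of essential ones. -/
theorem hornForm_nonneg_of_essential (hn : 1 ≤ n) {q : Quadruple n m}
    (htr : traceForm n m q = 0) (h : ∀ I J, IsEssential I J → 0 ≤ hornForm I J q)
    (I : Finset (Fin n)) (J : Finset (Fin m)) : 0 ≤ hornForm I J q := by
  by_cases h0 : I.card = 0
  · rw [Finset.card_eq_zero.1 h0, hornForm_empty]
    exact Finset.sum_nonneg fun j _ => h _ _ (isEssential_empty_singleton hn j)
  by_cases h1 : I.card = n
  · rw [Finset.eq_univ_of_card I (by simpa using h1), hornForm_univ htr]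
    exact Finset.sum_nonneg fun j _ => h _ _ (isEssential_univ_compl_singleton hn j)
  · have := card_finset_fin_le I
    have := card_finset_fin_le J
    exact h I J ⟨by omega, Or.inl ⟨h0, h1⟩⟩

/-- In the exceptional cases the chamber inequalities are sums of essential Horn-type ones. -/
theorem chamberForm_nonneg_of_essential (hnm : n = 1 ∨ (n = 2 ∧ m = 0)) {q : Quadruple n m}
    (htr : traceForm n m q = 0) (h : ∀ I J, IsEssential I J → 0 ≤ hornForm I J q)
    (k : Fin (n + m - 1) ⊕ Fin (m - 1)) : 0 ≤ chamberForm k q := by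
  have hL := fun j => (extendZero_val q.lam j).symm
  have hB := fun j => (extendZero_val q.lamBar j).symm
  rcases hnm with rfl | ⟨rfl, rfl⟩
  · have h1 : ∀ j (_ : j < m), extendZero q.lamBar j ≤ extendZero q.lam j := by
      intro j hj
      have := h _ _ (isEssential_empty_singleton le_rfl ⟨j, hj⟩)
      rw [hornForm_eq hL hB] at this
      simpa using this
    have h2 : ∀ j (_ : j < m), extendZero q.lam (j + 1) ≤ extendZero q.lamBar j := by
      intro j hj
      have := h _ _ (isEssential_univ_compl_singleton le_rfl ⟨j, hj⟩)
      rw [hornForm_univ_eq, htr] at this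
      simpa [add_comm] using this
    rcases k with ⟨j, hj⟩ | ⟨j, hj⟩
    · simp only [chamberForm, hL, sub_nonneg]
      exact (h2 j (by omega)).trans (h1 j (by omega))
    · simp only [chamberForm, hB, sub_nonneg]
      exact (h1 (j + 1) (by omega)).trans (h2 j (by omega))
  · have h1 := fun i : Fin 2 => h {i} ∅ (by simp [IsEssential])
    have h2 := h1 0
    have h3 := h1 1
    rw [hornForm_eq hL hB] at h2 h3
    rw [traceForm_eq hL hB] at htr
    rcases k with ⟨j, hj⟩ | ⟨j, hj⟩
    · obtain rfl : j = 0 := by omega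
      simp [chamberForm, hL, Finset.sum_range_succ] at h2 h3 htr ⊢
      linarith
    · omega

/-- Indices of the facets: the essential pairs and, outside of the exceptional cases, the
chamber inequalities. -/
abbrev FacetIndex (n m : ℕ) : Type :=
  {p : Finset (Fin n) × Finset (Fin m) // IsEssential p.1 p.2} ⊕
    {_k : Fin (n + m - 1) ⊕ Fin (m - 1) // ¬(n = 1 ∨ (n = 2 ∧ m = 0))}

/-- The linear form of the inequality determining the facet with the given index. -/
def facetForm : FacetIndex n m → Quadruple n m →ₗ[ℝ] ℝ
  | Sum.inl p => hornLinear p.1.1 p.1.2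
  | Sum.inr k => chamberLinear k.1

theorem boundaryCone_eq_subspaceCone (hn : 1 ≤ n) :
    boundaryCone n m = subspaceCone (LinearMap.ker (traceForm n m)) facetForm := by
  ext q
  constructor
  · intro hq
    refine ⟨traceForm_eq_zero hq, ?_⟩
    rintro (p | k)
    · exact hornForm_nonneg hq _ _
    · exact chamberForm_nonneg hn hq _
  · rintro ⟨htr, hq⟩
    have hess : ∀ I J, IsEssential I J → 0 ≤ hornForm I J q :=
      fun I J h => hq (Sum.inl ⟨(I, J), h⟩)
    refine mem_boundaryCone_of_nonneg htr (fun k => ?_)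
      (hornForm_nonneg_of_essential hn htr hess)
    by_cases hnm : n = 1 ∨ (n = 2 ∧ m = 0)
    · exact chamberForm_nonneg_of_essential hnm htr hess k
    · exact hq (Sum.inr ⟨k, hnm⟩)

end Description

/-! ### Points at which a single Horn-type inequality is tight -/

section Points

variable {n m : ℕ}

/-- The quadruple `(λ, λ̄, 0, w)` with `λ` and `λ̄` given by sequences indexed by `ℕ`. -/
def mkPoint (n m : ℕ) (L B : ℕ → ℝ) (w : Fin n → ℝ) : Quadruple n m :=
  (fun j => L j, fun j => B j, 0, w)

theorem hornForm_mkPoint (L B : ℕ → ℝ) (w : Fin n → ℝ) (I : Finset (Fin n))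
    (J : Finset (Fin m)) : hornForm I J (mkPoint n m L B w) =
      ∑ j ∈ Finset.range I.card, L j + ∑ j ∈ J, (L (I.card + j) - B j) - ∑ i ∈ I, w i := by
  rw [hornForm_eq (L := L) (B := B) (fun _ => rfl) fun _ => rfl]
  simp [mkPoint, Quadruple.mu, Quadruple.nu]

theorem traceForm_mkPoint (L B : ℕ → ℝ) (w : Fin n → ℝ) :
    traceForm n m (mkPoint n m L B w) = ∑ j ∈ Finset.range n, L j +
      ∑ j : Fin m, (L (n + j) - B j) - ∑ i, w i := by
  rw [traceForm_eq (L := L) (B := B) (fun _ => rfl) fun _ => rfl, Finset.sum_range_add,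
    Finset.sum_range (n := m), Finset.sum_range (n := m), Finset.sum_sub_distrib]
  simp [mkPoint, Quadruple.mu, Quadruple.nu]
  ring

theorem hornForm_univ_mkPoint {L B : ℕ → ℝ} {w : Fin n → ℝ}
    (h : traceForm n m (mkPoint n m L B w) = 0) (J : Finset (Fin m)) :
    hornForm Finset.univ J (mkPoint n m L B w) = ∑ j ∈ Jᶜ, (B j - L (n + j)) := by
  rw [hornForm_univ_eq, h, zero_add]
  refine Finset.sum_congr rfl fun j _ => congrArg₂ _ ?_ ?_
  · exact extendZero_val _ j
  · exact extendZero_val (mkPoint n m L B w).lam ⟨n + j, by omega⟩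

theorem sum_range_neg_natCast (k : ℕ) :
    ∑ j ∈ Finset.range k, (-(j : ℝ)) = -(k * (k - 1) / 2) := by
  induction k with
  | zero => simp
  | succ k ih =>
    rw [Finset.sum_range_succ, ih]
    push_cast
    ring

/-- `∑ max(ε_j, 0)`. -/
noncomputable def posSum (ε : Fin m → ℝ) : ℝ := ∑ j, max (ε j) 0

/-- A quadruple at which the chamber inequalities and the essential Horn-type inequalities for
`(I', J')` with `I' ≠ I` are strict, and the Horn-type form for `(I, J)` has the value
`posSum ε - ∑ j ∈ J, ε j`. Here `λ_j = -j`, the entry `λ̄_j` is `λ_{j + |I|}` perturbed by `ε j`,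
and the weight is constant on `I` and on the complement of `I`, where the two constants are forced
by the trace equality and by tightness for `J = {j | 0 ≤ ε j}`. -/
noncomputable def hornPoint (I : Finset (Fin n)) (ε : Fin m → ℝ) : Quadruple n m :=
  mkPoint n m (fun j => -j) (fun j => extendZero ε j - (j + I.card)) fun i =>
    if i ∈ I then -((I.card - 1 : ℝ) / 2) - posSum ε / I.card
    else -((n + I.card - 1 : ℝ) / 2) - m + posSum (-ε) / (n - I.card)

/-- The perturbations allowed in `hornPoint`. -/
structure IsPerturbation (I : Finset (Fin n)) (ε : Fin m → ℝ) : Prop where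
  abs_apply_le : ∀ j, |ε j| ≤ 1 / 4
  nonpos : I.card = 0 → ∀ j, ε j ≤ 0
  nonneg : I.card = n → ∀ j, 0 ≤ ε j

theorem posSum_nonneg (ε : Fin m → ℝ) : 0 ≤ posSum ε :=
  Finset.sum_nonneg fun _ _ => le_max_right _ _

theorem posSum_sub_posSum_neg (ε : Fin m → ℝ) : posSum ε - posSum (-ε) = ∑ j, ε j := by
  rw [posSum, posSum, ← Finset.sum_sub_distrib]
  refine Finset.sum_congr rfl fun j _ => ?_
  rw [Pi.neg_apply]
  rcases le_total (ε j) 0 with h | h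
  · rw [max_eq_right h, max_eq_left (by linarith)]
    ring
  · rw [max_eq_left h, max_eq_right (by linarith)]
    ring

theorem IsPerturbation.posSum_add_le {I : Finset (Fin n)} {ε : Fin m → ℝ}
    (h : IsPerturbation I ε) : posSum ε + posSum (-ε) ≤ m / 4 := by
  have : posSum ε + posSum (-ε) = ∑ j, |ε j| := by
    rw [posSum, posSum, ← Finset.sum_add_distrib]
    refine Finset.sum_congr rfl fun j _ => ?_
    rw [Pi.neg_apply]
    rcases le_total (ε j) 0 with h | h
    · rw [max_eq_right h, max_eq_left (by linarith), abs_of_nonpos h]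
      ring
    · rw [max_eq_left h, max_eq_right (by linarith), abs_of_nonneg h]
      ring
  rw [this]
  refine (Finset.sum_le_sum fun j _ => h.abs_apply_le j).trans (le_of_eq ?_)
  simp
  ring

theorem sum_le_posSum (ε : Fin m → ℝ) (J : Finset (Fin m)) : ∑ j ∈ J, ε j ≤ posSum ε :=
  (Finset.sum_le_sum fun _ _ => le_max_left _ _).trans
    (Finset.sum_le_sum_of_subset_of_nonneg (Finset.subset_univ J) fun _ _ _ => le_max_right _ _)

theorem posSum_eq_sum {ε : Fin m → ℝ} {J : Finset (Fin m)} (h : ∀ j ∈ J, 0 ≤ ε j)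
    (h' : ∀ j ∉ J, ε j ≤ 0) : posSum ε = ∑ j ∈ J, ε j := by
  rw [posSum, ← Finset.sum_subset (Finset.subset_univ J) fun _ _ hj => max_eq_right (h' _ hj)]
  exact Finset.sum_congr rfl fun j hj => max_eq_left (h j hj)

theorem sum_lt_posSum {ε : Fin m → ℝ} {J : Finset (Fin m)} {j : Fin m}
    (hj : (j ∈ J ∧ ε j < 0) ∨ (j ∉ J ∧ 0 < ε j)) : ∑ j ∈ J, ε j < posSum ε := by
  rcases hj with ⟨hj, h⟩ | ⟨hj, h⟩
  · have := sum_le_posSum ε (J.erase j)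
    rw [← Finset.add_sum_erase J ε hj]
    linarith
  · have := sum_le_posSum ε (insert j J)
    rw [Finset.sum_insert hj] at this
    linarith

variable {I : Finset (Fin n)} {ε : Fin m → ℝ}

theorem IsPerturbation.card_mul_div (h : IsPerturbation I ε) :
    (I.card : ℝ) * (posSum ε / I.card) = posSum ε := by
  by_cases hk : I.card = 0
  · have : posSum ε = 0 := by
      rw [posSum_eq_sum (J := ∅) (by simp) fun j _ => h.nonpos hk j, Finset.sum_empty]
    simp [this]
  · have : (I.card : ℝ) ≠ 0 := by exact_mod_cast hk
    field_simp

theorem IsPerturbation.sub_card_mul_div (h : IsPerturbation I ε) :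
    (n - I.card : ℝ) * (posSum (-ε) / (n - I.card)) = posSum (-ε) := by
  by_cases hk : I.card = n
  · have : posSum (-ε) = 0 := by
      rw [posSum_eq_sum (J := ∅) (by simp) fun j _ => by simpa using h.nonneg hk j,
        Finset.sum_empty]
    simp [this]
  · have : (n : ℝ) - I.card ≠ 0 := sub_ne_zero.2 (by exact_mod_cast Ne.symm hk)
    field_simp

theorem IsPerturbation.div_add_div_le (h : IsPerturbation I ε) :
    posSum ε / I.card + posSum (-ε) / (n - I.card) ≤ m / 4 := by
  refine le_trans (add_le_add ?_ ?_) h.posSum_add_le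
  · by_cases hk : I.card = 0
    · simp [hk, posSum_nonneg]
    · exact div_le_self (posSum_nonneg _) (by exact_mod_cast Nat.one_le_iff_ne_zero.2 hk)
  · by_cases hk : I.card = n
    · simp [hk, posSum_nonneg]
    · have := card_finset_fin_le I
      have h1 : I.card + 1 ≤ n := by omega
      have h2 : (I.card : ℝ) + 1 ≤ n := by exact_mod_cast h1
      exact div_le_self (posSum_nonneg _) (by linarith)

theorem hornForm_hornPoint (I' : Finset (Fin n)) (J' : Finset (Fin m)) :
    hornForm I' J' (hornPoint I ε) = -(I'.card * (I'.card - 1) / 2 : ℝ) +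
      ∑ j ∈ J', ((I.card : ℝ) - I'.card - ε j) -
      ((I'.filter (· ∈ I)).card * (-((I.card - 1 : ℝ) / 2) - posSum ε / I.card) +
        (I'.filter (· ∉ I)).card *
          (-((n + I.card - 1 : ℝ) / 2) - m + posSum (-ε) / (n - I.card))) := by
  rw [hornPoint, hornForm_mkPoint, sum_range_neg_natCast, Finset.sum_ite, Finset.sum_const,
    Finset.sum_const, nsmul_eq_mul, nsmul_eq_mul]
  congr 2
  refine Finset.sum_congr rfl fun j _ => ?_
  rw [extendZero_val]
  push_cast
  ring

theorem IsPerturbation.traceForm_hornPoint (h : IsPerturbation I ε) :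
    traceForm n m (hornPoint I ε) = 0 := by
  have h1 := h.card_mul_div
  have h2 := h.sub_card_mul_div
  have h3 := posSum_sub_posSum_neg ε
  have h4 : (Finset.univ.filter (· ∈ I)).card = I.card := by simp
  have h5 : ((Finset.univ.filter (· ∉ I)).card : ℝ) = n - I.card := by
    rw [Finset.filter_not, Finset.filter_univ_mem I, ← Finset.compl_eq_univ_sdiff,
      Finset.card_compl, Fintype.card_fin, Nat.cast_sub (card_finset_fin_le I)]
  rw [hornPoint, traceForm_mkPoint, sum_range_neg_natCast, Finset.sum_ite, Finset.sum_const,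
    Finset.sum_const, nsmul_eq_mul, nsmul_eq_mul, h4, h5]
  have h6 : ∑ j : Fin m, (-((n + j : ℕ) : ℝ) - (extendZero ε j - (j + I.card))) =
      m * (I.card - n) - ∑ j, ε j := by
    have e : ∑ _j : Fin m, ((I.card : ℝ) - n) = m * (I.card - n) := by
      rw [Finset.sum_const, Finset.card_fin, nsmul_eq_mul]
    rw [← e, ← Finset.sum_sub_distrib]
    refine Finset.sum_congr rfl fun j _ => ?_
    rw [extendZero_val]
    push_cast
    ring
  rw [h6]
  linear_combination h1 - h2 + h3

theorem IsPerturbation.hornForm_hornPoint_self (h : IsPerturbation I ε) (J' : Finset (Fin m)) :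
    hornForm I J' (hornPoint I ε) = posSum ε - ∑ j ∈ J', ε j := by
  rw [hornForm_hornPoint]
  have h1 := h.card_mul_div
  have h2 : I.filter (· ∈ I) = I := Finset.filter_true_of_mem fun _ h => h
  have h3 : I.filter (· ∉ I) = ∅ := Finset.filter_false_of_mem fun _ h => not_not.2 h
  rw [h2, h3]
  simp only [sub_self, zero_sub, Finset.sum_neg_distrib, Finset.card_empty, Nat.cast_zero]
  linear_combination h1

theorem IsPerturbation.hornForm_hornPoint_pos (h : IsPerturbation I ε) {I' : Finset (Fin n)}
    (hne : I' ≠ I) (h0 : 0 < I'.card) (hn : I'.card < n) (J' : Finset (Fin m)) :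
    0 < hornForm I' J' (hornPoint I ε) := by
  have h1 := h.card_mul_div
  have h2 := h.sub_card_mul_div
  have h3 := posSum_sub_posSum_neg ε
  have h4 := h.div_add_div_le
  have hst : ((I'.filter (· ∈ I)).card : ℝ) + (I'.filter (· ∉ I)).card = I'.card := by
    exact_mod_cast Finset.card_filter_add_card_filter_not (s := I') (· ∈ I)
  have hs : ((I'.filter (· ∈ I)).card : ℝ) ≤ I.card := by
    exact_mod_cast Finset.card_le_card fun i hi => (Finset.mem_filter.1 hi).2
  have ht : (0 : ℝ) ≤ (I'.filter (· ∉ I)).card := Nat.cast_nonneg _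
  have ht0 : I'.card = I.card → (0 : ℝ) < (I'.filter (· ∉ I)).card := by
    intro hc
    rw [Nat.cast_pos, Finset.card_pos, Finset.filter_nonempty_iff]
    by_contra! hsub
    exact hne (Finset.eq_of_subset_of_card_le hsub hc.ge)
  have hα : 0 ≤ posSum ε / I.card := div_nonneg (posSum_nonneg _) (Nat.cast_nonneg _)
  have hkn : (I.card : ℝ) ≤ n := by exact_mod_cast card_finset_fin_le I
  have hβ : 0 ≤ posSum (-ε) / (n - I.card) := div_nonneg (posSum_nonneg _) (by linarith)
  have h0' : (0 : ℝ) < I'.card := by exact_mod_cast h0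
  have hn' : (I'.card : ℝ) < n := by exact_mod_cast hn
  have hm : (0 : ℝ) ≤ m := Nat.cast_nonneg _
  rw [hornForm_hornPoint]
  set s := ((I'.filter (· ∈ I)).card : ℝ)
  set t := ((I'.filter (· ∉ I)).card : ℝ)
  set α := posSum ε / I.card
  set β := posSum (-ε) / (n - I.card)
  -- the weight is larger on `I` than off `I`
  have hab : 0 < (-((I.card - 1 : ℝ) / 2) - α) - (-((n + I.card - 1 : ℝ) / 2) - m + β) := by
    linarith
  rcases lt_trichotomy I'.card I.card with hlt | heq | hgt
  · have hlt' : (I'.card : ℝ) + 1 ≤ I.card := by exact_mod_cast hlt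
    have hJ : 0 ≤ ∑ j ∈ J', ((I.card : ℝ) - I'.card - ε j) := Finset.sum_nonneg fun j _ => by
      have := (abs_le.1 (h.abs_apply_le j)).2
      linarith
    have e1 := mul_nonneg ht hab.le
    have e2 : 0 < (I'.card : ℝ) * (I.card - I'.card) := mul_pos h0' (by linarith)
    have e3 := mul_nonneg h0'.le hα
    have es : s = I'.card - t := by linarith
    rw [es]
    linarith
  · have hJ : -∑ j ∈ J', ε j = ∑ j ∈ J', ((I.card : ℝ) - I'.card - ε j) := by
      rw [← Finset.sum_neg_distrib]
      exact Finset.sum_congr rfl fun j _ => by rw [heq]; ring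
    have e1 := mul_pos (ht0 heq) hab
    have e2 := sum_le_posSum ε J'
    have es : s = I'.card - t := by linarith
    rw [es, ← hJ, heq]
    linarith
  · have hgt' : (I.card : ℝ) + 1 ≤ I'.card := by exact_mod_cast hgt
    have hJ : m * ((I.card : ℝ) - I'.card) - ∑ j, ε j ≤
        ∑ j ∈ J', ((I.card : ℝ) - I'.card - ε j) := by
      have e : m * ((I.card : ℝ) - I'.card) - ∑ j, ε j =
          ∑ j : Fin m, ((I.card : ℝ) - I'.card - ε j) := by
        simp [Finset.sum_sub_distrib]
        ring
      rw [e, ← Finset.sum_add_sum_compl J']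
      have : ∑ j ∈ J'ᶜ, ((I.card : ℝ) - I'.card - ε j) ≤ 0 := Finset.sum_nonpos fun j _ => by
        have := (abs_le.1 (h.abs_apply_le j)).1
        linarith
      linarith
    have e1 := mul_nonneg (sub_nonneg.2 hs) hab.le
    have e2 : 0 < ((I'.card : ℝ) - I.card) * (n - I'.card) :=
      mul_pos (by linarith) (by linarith)
    have e3 : 0 ≤ ((n : ℝ) - I'.card) * β := mul_nonneg (by linarith) hβ
    have et : t = I'.card - s := by linarith
    rw [et]
    linarith

theorem IsPerturbation.hornForm_hornPoint_empty_pos (h : IsPerturbation I ε)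
    (hI : 0 < I.card) {J' : Finset (Fin m)} (hJ : J'.Nonempty) :
    0 < hornForm ∅ J' (hornPoint I ε) := by
  rw [hornForm_hornPoint]
  simp only [Finset.card_empty, Nat.cast_zero, zero_mul, zero_div, neg_zero, sub_zero, zero_add,
    Finset.filter_empty, add_zero]
  refine Finset.sum_pos (fun j _ => ?_) hJ
  have := (abs_le.1 (h.abs_apply_le j)).2
  have : (1 : ℝ) ≤ I.card := by exact_mod_cast hI
  linarith

theorem IsPerturbation.hornForm_hornPoint_univ_pos (h : IsPerturbation I ε)
    (hI : I.card < n) {J' : Finset (Fin m)} (hJ : J'ᶜ.Nonempty) :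
    0 < hornForm Finset.univ J' (hornPoint I ε) := by
  rw [hornPoint, hornForm_univ_mkPoint h.traceForm_hornPoint]
  refine Finset.sum_pos (fun j _ => ?_) hJ
  rw [extendZero_val]
  have := (abs_le.1 (h.abs_apply_le j)).1
  have : (I.card : ℝ) + 1 ≤ n := by exact_mod_cast hI
  push_cast
  linarith

theorem IsPerturbation.hornForm_hornPoint_pos_of_ne (h : IsPerturbation I ε)
    {I' : Finset (Fin n)} {J' : Finset (Fin m)} (hess : IsEssential I' J') (hne : I' ≠ I) :
    0 < hornForm I' J' (hornPoint I ε) := by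
  have hIn := card_finset_fin_le I
  rcases hess.2 with ⟨h0, hn⟩ | ⟨h0, hJ⟩ | ⟨hn, hJ⟩
  · have := card_finset_fin_le I'
    exact h.hornForm_hornPoint_pos hne (by omega) (by omega) J'
  · rw [Finset.card_eq_zero] at h0
    subst h0
    exact h.hornForm_hornPoint_empty_pos (Finset.card_pos.2 (Finset.nonempty_iff_ne_empty.2
      hne.symm)) (Finset.card_pos.1 (by omega))
  · obtain rfl := Finset.eq_univ_of_card I' (by simpa using hn)
    refine h.hornForm_hornPoint_univ_pos (lt_of_le_of_ne hIn fun hc => ?_)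
      (Finset.card_pos.1 ?_)
    · exact hne (Finset.eq_univ_of_card I (by simpa using hc)).symm
    · rw [Finset.card_compl, Fintype.card_fin]
      omega

theorem IsPerturbation.chamberForm_hornPoint_pos (h : IsPerturbation I ε)
    (k : Fin (n + m - 1) ⊕ Fin (m - 1)) : 0 < chamberForm k (hornPoint I ε) := by
  rcases k with ⟨j, hj⟩ | ⟨j, hj⟩
  · simp [chamberForm, hornPoint, mkPoint, Quadruple.lam]
  · have h1 := (abs_le.1 (h.abs_apply_le ⟨j, by omega⟩)).1
    have h2 := (abs_le.1 (h.abs_apply_le ⟨j + 1, by omega⟩)).2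
    rw [← extendZero_val ε] at h1 h2
    simp only [chamberForm, hornPoint, mkPoint, Quadruple.lamBar]
    push_cast
    linarith

theorem exists_interior_point (hn : 1 ≤ n) : ∃ q : Quadruple n m, traceForm n m q = 0 ∧
    (∀ k, 0 < chamberForm k q) ∧ ∀ I J, IsEssential I J → 0 < hornForm I J q := by
  have h : IsPerturbation (∅ : Finset (Fin n)) (fun _ : Fin m => (-1 / 4 : ℝ)) := by
    refine ⟨fun j => ?_, fun _ j => by norm_num, fun hc => ?_⟩
    · rw [abs_of_neg] <;> norm_num
    · simp at hc
      omega
  refine ⟨_, h.traceForm_hornPoint, h.chamberForm_hornPoint_pos, fun I J hess => ?_⟩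
  by_cases hI : I = ∅
  · subst hI
    obtain ⟨j, hj⟩ : J.Nonempty := by
      have := hess.1.1
      rw [Finset.card_empty, zero_add] at this
      exact Finset.card_pos.1 this
    rw [h.hornForm_hornPoint_self, sub_pos]
    exact sum_lt_posSum (Or.inl ⟨hj, by norm_num⟩)
  · exact h.hornForm_hornPoint_pos_of_ne hess hI

theorem exists_point_tight_horn (hn : 1 ≤ n) {I : Finset (Fin n)} {J : Finset (Fin m)}
    (hess : IsEssential I J) : ∃ q : Quadruple n m, traceForm n m q = 0 ∧
    (∀ k, 0 < chamberForm k q) ∧ hornForm I J q = 0 ∧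
    ∀ I' J', IsEssential I' J' → ¬(I' = I ∧ J' = J) → 0 < hornForm I' J' q := by
  let ε : Fin m → ℝ := fun j =>
    if j ∈ J then (if I.card = 0 then 0 else 1 / 4) else (if I.card = n then 0 else -(1 / 4))
  have hpos : ∀ j ∈ J, 0 ≤ ε j := by
    intro j hj
    simp only [ε, if_pos hj]
    split_ifs <;> norm_num
  have hneg : ∀ j ∉ J, ε j ≤ 0 := by
    intro j hj
    simp only [ε, if_neg hj]
    split_ifs <;> norm_num
  have h : IsPerturbation I ε := by
    refine ⟨fun j => ?_, fun h0 j => ?_, fun hc j => ?_⟩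
    · simp only [ε]
      split_ifs <;> norm_num [abs_of_pos]
    · simp only [ε, if_pos h0]
      split_ifs <;> norm_num
    · simp only [ε, if_pos hc]
      split_ifs <;> norm_num
  refine ⟨_, h.traceForm_hornPoint, h.chamberForm_hornPoint_pos, ?_, fun I' J' hess' hne => ?_⟩
  · rw [h.hornForm_hornPoint_self, posSum_eq_sum hpos hneg, sub_self]
  by_cases hI : I' = I
  · subst hI
    have hJ : J' ≠ J := fun hc => hne ⟨rfl, hc⟩
    rw [h.hornForm_hornPoint_self, sub_pos]
    suffices ∃ j, (j ∈ J' ∧ ε j < 0) ∨ (j ∉ J' ∧ 0 < ε j) by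
      obtain ⟨j, hj⟩ := this
      exact sum_lt_posSum hj
    rcases hess.2 with ⟨h0, hc⟩ | ⟨h0, hcJ⟩ | ⟨hc, hcJ⟩
    · obtain ⟨j, hj⟩ : ∃ j, ¬(j ∈ J' ↔ j ∈ J) := by
        by_contra! hcon
        exact hJ (Finset.ext hcon)
      refine ⟨j, ?_⟩
      by_cases hjJ : j ∈ J <;> simp [ε, hjJ, h0, hc] at hj ⊢ <;> tauto
    -- the cardinalities of `J` and `J'` agree, so that neither contains the other
    · have hcJ' : J'.card = 1 := by rcases hess'.2 with h | h | h <;> omega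
      obtain ⟨j, hj, hj'⟩ := Finset.not_subset.1 fun hs =>
        hJ (Finset.eq_of_subset_of_card_le hs (by omega))
      exact ⟨j, Or.inl ⟨hj, by simp [ε, hj', h0, show ¬ 0 = n by omega]⟩⟩
    · have hcJ' : J'.card + 1 = m := by rcases hess'.2 with h | h | h <;> omega
      obtain ⟨j, hj, hj'⟩ := Finset.not_subset.1 fun hs =>
        hJ (Finset.eq_of_subset_of_card_le hs (by omega)).symm
      exact ⟨j, Or.inr ⟨hj', by simp [ε, hj, show ¬ I'.card = 0 by omega]⟩⟩
  · exact h.hornForm_hornPoint_pos_of_ne hess' hI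

end Points

/-! ### Points at which a single chamber inequality is tight -/

section ChamberPoints

variable {n m : ℕ}

/-- A quadruple with constant weight at which the essential Horn-type inequalities are strict, for
perturbations `η` of `λ` and `ζ` of `λ̄` that are nonnegative, of total size `1`, and can make a
chamber inequality tight; the constant is forced by the trace equality. -/
noncomputable def chamberPoint (n m : ℕ) (η ζ : ℕ → ℝ) : Quadruple n m :=
  mkPoint n m (fun j => -j + η j) (fun j => -j - 1 / 4 - ζ j) fun _ =>
    (-(n * (n - 1) / 2) + m * (1 / 4 - n) + 1) / n

variable {η ζ : ℕ → ℝ}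

theorem traceForm_chamberPoint (hn : 1 ≤ n)
    (h : ∑ j ∈ Finset.range (n + m), η j + ∑ j ∈ Finset.range m, ζ j = 1) :
    traceForm n m (chamberPoint n m η ζ) = 0 := by
  have hn' : (n : ℝ) ≠ 0 := by positivity
  rw [chamberPoint, traceForm_mkPoint, Finset.sum_add_distrib, sum_range_neg_natCast,
    Finset.sum_const, Finset.card_fin, nsmul_eq_mul, mul_div_cancel₀ _ hn']
  have e : ∑ j : Fin m, (-((n + j : ℕ) : ℝ) + η (n + j) - (-j - 1 / 4 - ζ j)) =
      m * (1 / 4 - n) + (∑ j : Fin m, η (n + j) + ∑ j : Fin m, ζ j) := by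
    have e : ∑ _j : Fin m, (1 / 4 - n : ℝ) = m * (1 / 4 - n) := by
      rw [Finset.sum_const, Finset.card_fin, nsmul_eq_mul]
    rw [← e, ← Finset.sum_add_distrib, ← Finset.sum_add_distrib]
    refine Finset.sum_congr rfl fun j _ => ?_
    push_cast
    ring
  rw [Finset.sum_range_add, Finset.sum_range (n := m), Finset.sum_range (n := m)] at h
  rw [e]
  linarith

theorem hornForm_chamberPoint_pos (hn : 2 ≤ n) (hnm : ¬(n = 2 ∧ m = 0)) (hη : ∀ j, 0 ≤ η j)
    (hζ : ∀ j, 0 ≤ ζ j) (hle : ∀ i j, η i + ζ j ≤ 1)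
    (h : ∑ j ∈ Finset.range (n + m), η j + ∑ j ∈ Finset.range m, ζ j = 1)
    {I : Finset (Fin n)} {J : Finset (Fin m)} (hess : IsEssential I J) :
    0 < hornForm I J (chamberPoint n m η ζ) := by
  have hn' : (2 : ℝ) ≤ n := by exact_mod_cast hn
  rcases hess.2 with ⟨h0, hc⟩ | ⟨h0, hJ⟩ | ⟨hc, hJ⟩
  · have hlt : I.card < n := lt_of_le_of_ne (card_finset_fin_le I) hc
    have h0' : (1 : ℝ) ≤ I.card := by exact_mod_cast Nat.one_le_iff_ne_zero.2 h0
    have hlt' : (I.card : ℝ) + 1 ≤ n := by exact_mod_cast hlt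
    rw [chamberPoint, hornForm_mkPoint, Finset.sum_add_distrib, sum_range_neg_natCast,
      Finset.sum_const, nsmul_eq_mul]
    have e1 : 0 ≤ ∑ j ∈ Finset.range I.card, η j := Finset.sum_nonneg fun j _ => hη j
    have e2 : m * (1 / 4 - (I.card : ℝ)) ≤
        ∑ j ∈ J, (-((I.card + j : ℕ) : ℝ) + η (I.card + j) - (-j - 1 / 4 - ζ j)) := by
      have e : ∑ _j : Fin m, (1 / 4 - I.card : ℝ) = m * (1 / 4 - I.card) := by
        rw [Finset.sum_const, Finset.card_fin, nsmul_eq_mul]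
      rw [← e, ← Finset.sum_add_sum_compl J]
      have e3 : ∑ _j ∈ Jᶜ, (1 / 4 - I.card : ℝ) ≤ 0 := Finset.sum_nonpos fun j _ => by linarith
      have e4 : ∑ _j ∈ J, (1 / 4 - I.card : ℝ) ≤
          ∑ j ∈ J, (-((I.card + j : ℕ) : ℝ) + η (I.card + j) - (-j - 1 / 4 - ζ j)) :=
        Finset.sum_le_sum fun j _ => by
          have := hη (I.card + j)
          have := hζ j
          push_cast
          linarith
      linarith
    have hm : (0 : ℝ) ≤ m := Nat.cast_nonneg m
    generalize (I.card : ℝ) = k at *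
    have key : 0 < n * (k * (n - k)) / 2 + m * (n - k) / 4 - k := by
      have h1 : k * 1 ≤ k * (n - k) := mul_le_mul_of_nonneg_left (by linarith) (by linarith)
      have h2 : (m : ℝ) * 1 ≤ m * (n - k) := mul_le_mul_of_nonneg_left (by linarith) hm
      rcases Nat.lt_or_ge 2 n with h3 | h3
      · have h3' : (3 : ℝ) ≤ n := by exact_mod_cast h3
        have := mul_le_mul_of_nonneg_right h3' (by linarith : 0 ≤ k * (n - k))
        linarith
      · have h4 : (1 : ℝ) ≤ m := by
          have : 1 ≤ m := by omega
          exact_mod_cast this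
        have := mul_le_mul_of_nonneg_right hn' (by linarith : 0 ≤ k * (n - k))
        linarith
    have hk : k * ((-(n * (n - 1) / 2) + m * (1 / 4 - n) + 1) / n) =
        -(k * (k - 1) / 2) + m * (1 / 4 - k) -
          (n * (k * (n - k)) / 2 + m * (n - k) / 4 - k) / n := by
      field_simp
      ring
    rw [hk]
    have := div_pos key (by linarith : (0 : ℝ) < n)
    linarith
  · rw [Finset.card_eq_zero] at h0
    subst h0
    rw [chamberPoint, hornForm_mkPoint, Finset.card_empty, Finset.sum_range_zero,
      Finset.sum_empty, zero_add, sub_zero]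
    refine Finset.sum_pos (fun j _ => ?_) (Finset.card_pos.1 (by omega))
    have := hη (0 + j)
    have := hζ j
    push_cast
    linarith
  · obtain rfl := Finset.eq_univ_of_card I (by simpa using hc)
    have htr := traceForm_chamberPoint (by omega : 1 ≤ n) h
    rw [chamberPoint, hornForm_univ_mkPoint htr]
    refine Finset.sum_pos (fun j _ => ?_) (Finset.card_pos.1 ?_)
    · have := hle (n + j) j
      push_cast
      linarith
    · rw [Finset.card_compl, Fintype.card_fin]
      omega

theorem exists_point_tight_chamber (hn : 1 ≤ n) (hnm : ¬(n = 1 ∨ (n = 2 ∧ m = 0)))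
    (k : Fin (n + m - 1) ⊕ Fin (m - 1)) : ∃ q : Quadruple n m, traceForm n m q = 0 ∧
    chamberForm k q = 0 ∧ (∀ k', k' ≠ k → 0 < chamberForm k' q) ∧
    ∀ I J, IsEssential I J → 0 < hornForm I J q := by
  rw [not_or] at hnm
  have hn2 : 2 ≤ n := by omega
  rcases k with ⟨l, hl⟩ | ⟨l, hl⟩
  · have h : ∑ j ∈ Finset.range (n + m), (if j = l + 1 then 1 else 0 : ℝ) +
        ∑ _j ∈ Finset.range m, (0 : ℝ) = 1 := by
      rw [Finset.sum_ite_eq' (Finset.range (n + m)), if_pos (Finset.mem_range.2 (by omega))]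
      simp
    refine ⟨chamberPoint n m (fun j => if j = l + 1 then 1 else 0) fun _ => 0,
      traceForm_chamberPoint hn h, ?_, ?_, fun I J => hornForm_chamberPoint_pos hn2 hnm.2
      (fun j => by split_ifs <;> norm_num) (fun _ => le_rfl)
      (fun i j => by split_ifs <;> norm_num) h⟩
    · simp [chamberForm, chamberPoint, mkPoint, Quadruple.lam]
    · rintro (⟨j, hj⟩ | ⟨j, hj⟩) hne
      · have hjl : j ≠ l := by simpa using hne
        simp only [chamberForm, chamberPoint, mkPoint, Quadruple.lam, Nat.add_right_cancel_iff,
          if_neg hjl]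
        push_cast
        split_ifs <;> linarith
      · simp [chamberForm, chamberPoint, mkPoint, Quadruple.lamBar]
  · have h : ∑ _j ∈ Finset.range (n + m), (0 : ℝ) +
        ∑ j ∈ Finset.range m, (if j = l then 1 else 0 : ℝ) = 1 := by
      rw [Finset.sum_ite_eq' (Finset.range m), if_pos (Finset.mem_range.2 (by omega))]
      simp
    refine ⟨chamberPoint n m (fun _ => 0) fun j => if j = l then 1 else 0,
      traceForm_chamberPoint hn h, ?_, ?_, fun I J => hornForm_chamberPoint_pos hn2 hnm.2
      (fun _ => le_rfl) (fun j => by split_ifs <;> norm_num)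
      (fun i j => by split_ifs <;> norm_num) h⟩
    · simp [chamberForm, chamberPoint, mkPoint, Quadruple.lamBar]
      ring
    · rintro (⟨j, hj⟩ | ⟨j, hj⟩) hne
      · simp [chamberForm, chamberPoint, mkPoint, Quadruple.lam]
      · have hjl : j ≠ l := by simpa using hne
        simp only [chamberForm, chamberPoint, mkPoint, Quadruple.lamBar, if_neg hjl]
        push_cast
        split_ifs <;> linarith

end ChamberPoints

/-! ### The facets and their number -/

section Facets

variable {n m : ℕ}

theorem isIrredundant_facetForm (hn : 1 ≤ n) :
    IsIrredundant (LinearMap.ker (traceForm n m)) facetForm where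
  exists_interior := by
    obtain ⟨q, htr, hc, hH⟩ := exists_interior_point (m := m) hn
    refine ⟨q, htr, ?_⟩
    rintro (⟨p, hp⟩ | ⟨k, -⟩)
    · exact hH _ _ hp
    · exact hc k
  exists_tight := by
    rintro (⟨⟨I, J⟩, hess⟩ | ⟨k, hnm⟩)
    · obtain ⟨q, htr, hc, h0, hH⟩ := exists_point_tight_horn hn hess
      refine ⟨q, htr, h0, ?_⟩
      rintro (⟨⟨I', J'⟩, hess'⟩ | ⟨k, -⟩) hne
      · exact hH _ _ hess' fun h => hne (by simpa using h)
      · exact hc k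
    · obtain ⟨q, htr, h0, hc, hH⟩ := exists_point_tight_chamber hn hnm k
      refine ⟨q, htr, h0, ?_⟩
      rintro (⟨⟨I, J⟩, hess⟩ | ⟨k', hnm'⟩) hne
      · exact hH _ _ hess
      · exact hc k' fun h => hne (by simpa using h)

theorem isFacet_iff (hn : 1 ≤ n) {F : Set (Quadruple n m)} :
    IsFacet (boundaryCone n m) F ↔
      ∃ i : FacetIndex n m, tightSet (boundaryCone n m) (facetForm i) = F := by
  rw [boundaryCone_eq_subspaceCone hn]
  exact Set.ext_iff.1 (isIrredundant_facetForm hn).setOf_isFacet F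

theorem injective_tightSet_facetForm (hn : 1 ≤ n) : Function.Injective
    fun i : FacetIndex n m => tightSet (boundaryCone n m) (facetForm i) := by
  rw [boundaryCone_eq_subspaceCone hn]
  exact (isIrredundant_facetForm hn).injective_tightSet

/-- If the Horn-type form for `(I, J)` is a sum of forms of at least two facets or of none, then
its tight set is not a facet. -/
theorem not_isFacet_of_hornForm_eq_sum (hn : 1 ≤ n) {I : Finset (Fin n)} {J S : Finset (Fin m)}
    (hS : S.card ≠ 1) {φ : Fin m → FacetIndex n m} (hφ : Function.Injective φ)
    (h : ∀ q ∈ boundaryCone n m, hornForm I J q = ∑ j ∈ S, facetForm (φ j) q) :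
    ¬IsFacet (boundaryCone n m) (tightSet (boundaryCone n m) (hornForm I J)) := by
  intro hF
  obtain ⟨i, hi⟩ := (isFacet_iff hn).1 hF
  have hnn : ∀ q ∈ boundaryCone n m, ∀ i : FacetIndex n m, 0 ≤ facetForm i q := by
    intro q hq
    rw [boundaryCone_eq_subspaceCone hn] at hq
    exact hq.2
  have hsub : ∀ j ∈ S, i = φ j := by
    intro j hj
    apply (isIrredundant_facetForm (m := m) hn).eq_of_tightSet_subset
    rw [← boundaryCone_eq_subspaceCone hn, hi]
    rintro q ⟨hq, hq0⟩
    rw [h q hq, Finset.sum_eq_zero_iff_of_nonneg fun j _ => hnn q hq _] at hq0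
    exact ⟨hq, hq0 j hj⟩
  have hS1 : S.card ≤ 1 := Finset.card_le_one.2 fun a ha b hb =>
    hφ ((hsub a ha).symm.trans (hsub b hb))
  have hS0 : S = ∅ := Finset.card_eq_zero.1 (by omega)
  obtain ⟨p, hpK, hp⟩ := (isIrredundant_facetForm (m := m) hn).exists_interior
  have hpB : p ∈ boundaryCone n m := by
    rw [boundaryCone_eq_subspaceCone hn]
    exact ⟨hpK, fun i => (hp i).le⟩
  have : p ∈ tightSet (boundaryCone n m) (hornForm I J) := ⟨hpB, by simp [h p hpB, hS0]⟩
  rw [← hi] at this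
  exact (hp i).ne' this.2

theorem determinesFacet_hornForm_iff (hn : 1 ≤ n) (I : Finset (Fin n)) (J : Finset (Fin m)) :
    DeterminesFacet (boundaryCone n m) (hornForm I J) ↔ IsEssential I J := by
  refine ⟨fun ⟨_, hF⟩ => ?_, fun hess => ⟨fun q hq => hornForm_nonneg hq I J, ?_⟩⟩
  · have hI := card_finset_fin_le I
    have hJ := card_finset_fin_le J
    by_contra hess
    by_cases h0 : I.card = 0
    · rw [Finset.card_eq_zero] at h0
      subst h0
      refine not_isFacet_of_hornForm_eq_sum hn (S := J) (fun hc => hess ?_)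
        (φ := fun j => Sum.inl ⟨(∅, {j}), isEssential_empty_singleton hn j⟩) (fun a b hab => ?_)
        (fun q _ => hornForm_empty J q) hF
      · obtain ⟨j, rfl⟩ := Finset.card_eq_one.1 hc
        exact isEssential_empty_singleton hn j
      · simpa using hab
    by_cases h1 : I.card = n
    · obtain rfl := Finset.eq_univ_of_card I (by simpa using h1)
      refine not_isFacet_of_hornForm_eq_sum hn (S := Jᶜ) (fun hc => hess ?_)
        (φ := fun j => Sum.inl ⟨(Finset.univ, {j}ᶜ), isEssential_univ_compl_singleton hn j⟩)
        (fun a b hab => ?_) (fun q hq => hornForm_univ (traceForm_eq_zero hq) J) hF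
      · obtain ⟨j, hj⟩ := Finset.card_eq_one.1 hc
        rw [← compl_compl J, hj]
        exact isEssential_univ_compl_singleton hn j
      · simpa using hab
    · exact hess ⟨by omega, Or.inl ⟨h0, h1⟩⟩
  · exact (isFacet_iff hn).2 ⟨Sum.inl ⟨(I, J), hess⟩, rfl⟩

theorem hornFacets_eq : hornFacets n m = Set.range fun p :
    {p : Finset (Fin n) × Finset (Fin m) // IsEssential p.1 p.2} =>
      tightSet (boundaryCone n m) (hornForm p.1.1 p.1.2) := by
  ext F
  constructor
  · rintro ⟨I, J, hess, rfl⟩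
    exact ⟨⟨(I, J), hess⟩, rfl⟩
  · rintro ⟨⟨⟨I, J⟩, hess⟩, rfl⟩
    exact ⟨I, J, hess, rfl⟩

theorem ncard_setOf_isFacet (hn : 1 ≤ n) :
    {F | IsFacet (boundaryCone n m) F}.ncard = Nat.card (FacetIndex n m) := by
  have : {F | IsFacet (boundaryCone n m) F} =
      Set.range fun i : FacetIndex n m => tightSet (boundaryCone n m) (facetForm i) :=
    Set.ext fun F => isFacet_iff hn
  rw [this, ← Set.image_univ, Set.ncard_image_of_injective _ (injective_tightSet_facetForm hn),
    Set.ncard_univ]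

theorem card_isEssential (hn : 1 ≤ n) :
    Nat.card {p : Finset (Fin n) × Finset (Fin m) // IsEssential p.1 p.2} =
      (2 ^ n - 2) * 2 ^ m + 2 * m := by
  classical
  have hset : (Finset.univ.filter fun p : Finset (Fin n) × Finset (Fin m) =>
      IsEssential p.1 p.2) =
      ((Finset.univ \ {∅, Finset.univ}) ×ˢ Finset.univ ∪
        ({∅} : Finset (Finset (Fin n))) ×ˢ Finset.univ.image fun j => {j}) ∪
        ({Finset.univ} : Finset (Finset (Fin n))) ×ˢ Finset.univ.image fun j => {j}ᶜ := by
    ext ⟨I, J⟩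
    have hI : I.card = n ↔ I = Finset.univ := by
      rw [← Finset.card_eq_iff_eq_univ, Fintype.card_fin]
    have hIn := card_finset_fin_le I
    have hJn := card_finset_fin_le J
    simp only [Finset.mem_filter, Finset.mem_univ, true_and, Finset.mem_union,
      Finset.mem_product, Finset.mem_sdiff, Finset.mem_insert, Finset.mem_singleton, and_true,
      Finset.mem_image]
    constructor
    · rintro ⟨h, ⟨h0, hc⟩ | ⟨h0, hJ⟩ | ⟨hc, hJ⟩⟩
      · rw [Ne, Finset.card_eq_zero] at h0
        exact Or.inl (Or.inl fun h => h.elim h0 (hc ∘ hI.2))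
      · obtain ⟨j, rfl⟩ := Finset.card_eq_one.1 hJ
        exact Or.inl (Or.inr ⟨Finset.card_eq_zero.1 h0, j, rfl⟩)
      · have hc1 : Jᶜ.card = 1 := by
          rw [Finset.card_compl, Fintype.card_fin]
          omega
        obtain ⟨j, hj⟩ := Finset.card_eq_one.1 hc1
        exact Or.inr ⟨hI.1 hc, j, by rw [← hj, compl_compl]⟩
    · rintro ((h | ⟨rfl, j, rfl⟩) | ⟨rfl, j, rfl⟩)
      · rw [not_or, ← hI, ← Finset.card_eq_zero] at h
        exact ⟨by omega, Or.inl h⟩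
      · exact isEssential_empty_singleton hn j
      · exact isEssential_univ_compl_singleton hn j
  have hne : (∅ : Finset (Fin n)) ≠ Finset.univ := by
    rw [Ne, eq_comm, Finset.univ_eq_empty_iff, not_isEmpty_iff]
    exact ⟨⟨0, hn⟩⟩
  rw [Nat.card_eq_fintype_card, Fintype.card_subtype, hset, Finset.card_union_of_disjoint,
    Finset.card_union_of_disjoint]
  · rw [Finset.card_product, Finset.card_product, Finset.card_product, Finset.card_sdiff_of_subset
      (Finset.subset_univ _), Finset.card_pair hne,
      Finset.card_image_of_injective _ Finset.singleton_injective,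
      Finset.card_image_of_injective Finset.univ (f := fun j : Fin m => ({j}ᶜ : Finset (Fin m)))
        (compl_injective.comp Finset.singleton_injective)]
    simp
    ring
  · rw [Finset.disjoint_left]
    simp only [Finset.mem_product, Finset.mem_sdiff, Finset.mem_insert, Finset.mem_singleton]
    exact fun p h h' => h.1.2 (Or.inl h'.1)
  · rw [Finset.disjoint_left]
    simp only [Finset.mem_union, Finset.mem_product, Finset.mem_sdiff, Finset.mem_insert,
      Finset.mem_singleton]
    rintro ⟨I, J⟩ (h | h) h'
    · exact h.1.2 (Or.inr h'.1)
    · exact hne (h.1.symm.trans h'.1)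

theorem ncard_setOf_isFacet_of_exceptional (hn : 1 ≤ n) (hnm : n = 1 ∨ (n = 2 ∧ m = 0)) :
    {F | IsFacet (boundaryCone n m) F}.ncard = (2 ^ n - 2) * 2 ^ m + 2 * m := by
  have : IsEmpty {_k : Fin (n + m - 1) ⊕ Fin (m - 1) // ¬(n = 1 ∨ (n = 2 ∧ m = 0))} :=
    ⟨fun k => k.2 hnm⟩
  rw [ncard_setOf_isFacet hn, Nat.card_sum, card_isEssential hn, Nat.card_of_isEmpty, add_zero]

theorem ncard_setOf_isFacet_of_not_exceptional (hn : 1 ≤ n)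
    (hnm : ¬(n = 1 ∨ (n = 2 ∧ m = 0))) :
    {F | IsFacet (boundaryCone n m) F}.ncard =
      (2 ^ n - 2) * 2 ^ m + 2 * m + ((n + m - 1) + (m - 1)) := by
  rw [ncard_setOf_isFacet hn, Nat.card_sum, card_isEssential hn,
    Nat.card_congr (Equiv.subtypeUnivEquiv fun _ => hnm), Nat.card_sum, Nat.card_fin,
    Nat.card_fin]

end Facets

end StripConcave

open StripConcave in
theorem theorem3 (n m : ℕ) (hn : 1 ≤ n) :
    -- which of the linearized Horn-type inequalities determine facets
    (∀ (I : Finset (Fin n)) (J : Finset (Fin m)),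
      DeterminesFacet (boundaryCone n m) (hornForm I J) ↔ IsEssential I J) ∧
    -- these facets are pairwise different
    (∀ (I I' : Finset (Fin n)) (J J' : Finset (Fin m)),
      IsEssential I J → IsEssential I' J' →
      tightSet (boundaryCone n m) (hornForm I J) =
        tightSet (boundaryCone n m) (hornForm I' J') → I = I' ∧ J = J') ∧
    -- there are no other facets if `n = 1` or `(n, m) = (2, 0)`
    ((n = 1 ∨ (n = 2 ∧ m = 0)) →
      {F | IsFacet (boundaryCone n m) F} = hornFacets n m) ∧
    -- otherwise the remaining facets are exactly those of the chamber inequalities,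
    -- each of which determines a facet, different ones for different inequalities
    (¬(n = 1 ∨ (n = 2 ∧ m = 0)) →
      (∀ k, DeterminesFacet (boundaryCone n m) (chamberForm k)) ∧
      (Function.Injective fun k : Fin (n + m - 1) ⊕ Fin (m - 1) =>
        tightSet (boundaryCone n m) (chamberForm k)) ∧
      {F | IsFacet (boundaryCone n m) F} \ hornFacets n m =
        Set.range fun k : Fin (n + m - 1) ⊕ Fin (m - 1) =>
          tightSet (boundaryCone n m) (chamberForm k)) ∧
    -- the number of facets
    {F | IsFacet (boundaryCone n m) F}.Finite ∧
    (2 ≤ n → (1 ≤ m ∨ n = 2) →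
      ({F | IsFacet (boundaryCone n m) F}.ncard : ℤ) =
        (2 ^ n - 2) * 2 ^ m + n + 4 * m - 2) ∧
    (3 ≤ n → m = 0 →
      ({F | IsFacet (boundaryCone n m) F}.ncard : ℤ) = 2 ^ n + n - 3) ∧
    (n = 1 → {F | IsFacet (boundaryCone n m) F}.ncard = 2 * m) := by
  have hinj := injective_tightSet_facetForm (m := m) hn
  have hpow : 2 ≤ 2 ^ n := by simpa using Nat.pow_le_pow_right (n := 2) (by norm_num) hn
  refine ⟨determinesFacet_hornForm_iff hn, fun I I' J J' h h' heq => ?_, fun hnm => ?_,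
    fun hnm => ⟨fun k => ⟨fun q hq => chamberForm_nonneg hn hq k, ?_⟩, fun k k' heq => ?_, ?_⟩,
    ?_, fun h2 hm => ?_, fun h3 hm => ?_, fun h1 => ?_⟩
  · have := @hinj (Sum.inl ⟨(I, J), h⟩) (Sum.inl ⟨(I', J'), h'⟩) heq
    simpa using this
  · rw [hornFacets_eq]
    ext F
    refine (isFacet_iff hn).trans ⟨?_, ?_⟩
    · rintro ⟨p | k, rfl⟩
      · exact ⟨p, rfl⟩
      · exact absurd hnm k.2
    · rintro ⟨p, rfl⟩
      exact ⟨Sum.inl p, rfl⟩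
  · exact (isFacet_iff hn).2 ⟨Sum.inr ⟨k, hnm⟩, rfl⟩
  · have := @hinj (Sum.inr ⟨k, hnm⟩) (Sum.inr ⟨k', hnm⟩) heq
    simpa using this
  · rw [hornFacets_eq]
    ext F
    constructor
    · rintro ⟨hF, hne⟩
      obtain ⟨p | k, rfl⟩ := (isFacet_iff hn).1 hF
      · exact absurd ⟨p, rfl⟩ hne
      · exact ⟨k.1, rfl⟩
    · rintro ⟨k, rfl⟩
      refine ⟨(isFacet_iff hn).2 ⟨Sum.inr ⟨k, hnm⟩, rfl⟩, ?_⟩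
      rintro ⟨p, hp⟩
      exact absurd (@hinj (Sum.inl p) (Sum.inr ⟨k, hnm⟩) hp) Sum.inl_ne_inr
  · have : {F | IsFacet (boundaryCone n m) F} =
        Set.range fun i : FacetIndex n m => tightSet (boundaryCone n m) (facetForm i) :=
      Set.ext fun F => isFacet_iff hn
    rw [this]
    exact Set.finite_range _
  · by_cases hnm : n = 1 ∨ (n = 2 ∧ m = 0)
    · obtain ⟨rfl, rfl⟩ : n = 2 ∧ m = 0 := by omega
      rw [ncard_setOf_isFacet_of_exceptional hn hnm]
      norm_num
    · have hm1 : 1 ≤ m := by omega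
      rw [ncard_setOf_isFacet_of_not_exceptional hn hnm]
      push_cast [Nat.cast_sub hpow, Nat.cast_sub hm1, Nat.cast_sub (show 1 ≤ n + m by omega)]
      ring
  · subst hm
    rw [ncard_setOf_isFacet_of_not_exceptional hn (by omega)]
    push_cast [Nat.cast_sub hpow, Nat.cast_sub (show 1 ≤ n + 0 by omega)]
    ring
  · subst h1
    rw [ncard_setOf_isFacet_of_exceptional hn (Or.inl rfl)]
    simp
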